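/- Let $\mathbb T^3=(\mathbb R/\mathbb Z)^3$ with its normalized Haar measure, and let $e_\Delta(k)=\sum_{i=1}^3\bigl(1-\cos(2\pi k_i)\bigr)$ for $k\in\mathbb T^3$. Let $I\subset\mathbb C$ be the contour $$I=[-1,7]\cup\bigl([-1,7]-i\bigr)\cup\bigl(-1-i(0,1]\bigr)\cup\bigl(7-i(0,1]\bigr),$$ and let $\bar I$ be its complex conjugate. For $\varepsilon>0$, $w\in\mathbb T^3$, $\alpha\in I$, $\beta\in\bar I$, a choice of $\alpha_1,\alpha_2,\alpha_3\in\{\alpha,\beta\}$ and an arbitrary, mutually independent choice of the four signs $\pm$, put $$A_\varepsilon(w;\alpha,\beta)=\int_{(\mathbb T^3)^2}\frac{dp\,dq}{|e_\Delta(p)-\alpha_1\pm i\varepsilon|\;|e_\Delta(q)-\alpha_2\pm i\varepsilon|\;|e_\Delta(p\pm q+w)-\alpha_3\pm i\varepsilon|}\in[0,\infty].$$ Then there is a constant $C<\infty$ such that for all $0<\varepsilon\le\frac12$, all choices of the signs, and all choices of which of $\alpha,\beta$ each $\alpha_j$ is, $$\sup_{w\in\mathbb T^3}\;\sup_{\alpha\in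 I}\;\sup_{\beta\in\bar I}\;A_\varepsilon(w;\alpha,\beta)<C\,\varepsilon^{-4/5}\Bigl(\log\frac1\varepsilon\Bigr)^2 .$$ -/

import Mathlib

namespace LatticeCrossing

open MeasureTheory
open scoped ENNReal

/-- The torus `𝕋³ = (ℝ/ℤ)³`. Its `volume` is the product of the Haar probability measures. -/
abbrev Torus3 : Type := Fin 3 → UnitAddCircle

theorem cos_two_pi_periodic :
    Function.Periodic (fun x : ℝ => Real.cos (2 * Real.pi * x)) 1 := by
  intro x
  simp only [mul_add, mul_one, Real.cos_add_two_pi]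

/-- The function `k ↦ cos (2 π k)` on the circle `ℝ/ℤ`. -/
noncomputable def cosTwoPi : UnitAddCircle → ℝ :=
  cos_two_pi_periodic.lift

/-- The lattice kinetic energy `e_Δ(k) = ∑ᵢ (1 - cos (2 π kᵢ))`. -/
noncomputable def kineticEnergy (k : Torus3) : ℝ :=
  ∑ i, (1 - cosTwoPi (k i))

/-- The contour `I = [-1,7] ∪ ([-1,7] - i) ∪ (-1 - i(0,1]) ∪ (7 - i(0,1])`, as a set. -/
def contour : Set ℂ :=
  Complex.reProdIm (Set.Icc (-1) 7) {0} ∪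
    (Complex.reProdIm (Set.Icc (-1) 7) {-1} ∪
      Complex.reProdIm {-1} (Set.Ico (-1) 0) ∪
      Complex.reProdIm {7} (Set.Ico (-1) 0))

/-- The complex conjugate of the contour. -/
def conjContour : Set ℂ := (starRingEnd ℂ) '' contour

/-- The modulus of the resolvent `1 / |e_Δ(k) - z + s i ε|` with sign `s = ±1`, as an element of
`[0,∞]` (it is `∞` where the denominator vanishes). -/
noncomputable def resolventModulus (ε : ℝ) (s : ℤˣ) (z : ℂ) (k : Torus3) : ℝ≥0∞ :=
  ‖(kineticEnergy k : ℂ) - z + ((s : ℤ) : ℂ) * Complex.I * (ε : ℂ)‖ₑ⁻¹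

/-- The crossing integral `A_ε(w; α, β)`. The signs in front of `iε` in the three resolvents are
`s 0, s 1, s 2`, the sign in `p ± q + w` is `κ`, and `ν` tells which of `α, β` is the spectral
parameter of each of the three resolvents. -/
noncomputable def crossingIntegral (s : Fin 3 → ℤˣ) (κ : ℤˣ) (ν : Fin 3 → Fin 2)
    (ε : ℝ) (w : Torus3) (α β : ℂ) : ℝ≥0∞ :=
  ∫⁻ x : Torus3 × Torus3,
    resolventModulus ε (s 0) (![α, β] (ν 0)) x.1 *
    resolventModulus ε (s 1) (![α, β] (ν 1)) x.2 *
    resolventModulus ε (s 2) (![α, β] (ν 2)) (x.1 + (κ : ℤ) • x.2 + w)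

end LatticeCrossing

/-!
The Fourier coefficients of a resolvent `(e_Δ - a - iδ)⁻¹` are Laplace transforms in time of the
free evolution `exp (-i t e_Δ)`, whose `n`-th coefficient is the product of the Bessel functions
`J_{nᵢ}(t)`. Van der Corput bounds for `J_n`, uniform across the turning point `t ≈ |n|`, make
that product integrable in `t`, and so the coefficients of the Lorentzian
`δ / ((e_Δ - a) ^ 2 + δ ^ 2)` decay like `(1 + |n|) ^ (-1/2)` *uniformly* in `δ` and `a`. On the
contour `|e_Δ - z ± iε|⁻¹` is dominated by the sum of these Lorentzians over the `O(log (1/ε))`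
dyadic widths `δ = 2 ^ l * ε`. By Parseval the crossing integral becomes the sum over `n ∈ ℤ³` of
a product of three coefficients: a box of `≈ ε ^ (-3/2)` frequencies is summed with the pointwise
decay, the remaining ones with decay for one factor and Cauchy–Schwarz, `∑ |c_n|² ≲ ε⁻¹`, for the
other two. This yields `ε ^ (-3/4) * log (1/ε) ^ 3`.
-/

namespace LatticeCrossing

open MeasureTheory UnitAddTorus
open scoped ENNReal ComplexConjugate

/-- The Lorentzian `δ / (δ² + x²)`, i.e. the Poisson kernel of the half plane up to a factor `π`. -/
noncomputable def lorentzian (δ x : ℝ) : ℝ := δ / (δ ^ 2 + x ^ 2)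

/-- The conjugate Poisson kernel `x / (δ² + x²)`, a regularisation of `1 / x` at scale `δ`. -/
noncomputable def conjLorentzian (δ x : ℝ) : ℝ := x / (δ ^ 2 + x ^ 2)

section Lorentzian

variable {δ : ℝ}

theorem lorentzian_nonneg (hδ : 0 ≤ δ) (x : ℝ) : 0 ≤ lorentzian δ x := by
  unfold lorentzian
  positivity

theorem lorentzian_le_inv (hδ : 0 < δ) (x : ℝ) : lorentzian δ x ≤ δ⁻¹ := by
  rw [lorentzian, inv_eq_one_div, div_le_div_iff₀ (by positivity) hδ]
  nlinarith [sq_nonneg x]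

theorem lorentzian_le_inv_two_mul {x y : ℝ} (hδ : 0 < δ) (hy : 0 < y) (hxy : y ≤ |x|) :
    lorentzian δ x ≤ (2 * y)⁻¹ := by
  rw [lorentzian, inv_eq_one_div, div_le_div_iff₀ (by positivity) (by positivity)]
  nlinarith [sq_abs x, sq_nonneg (δ - y)]

@[fun_prop]
theorem continuous_lorentzian (hδ : 0 < δ) : Continuous (lorentzian δ) :=
  continuous_const.div (by fun_prop) fun x => by positivity

theorem mul_conjLorentzian_add_mul_lorentzian (hδ : 0 < δ) (x : ℝ) :
    x * conjLorentzian δ x + δ * lorentzian δ x = 1 := by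
  have : δ ^ 2 + x ^ 2 ≠ 0 := by positivity
  unfold conjLorentzian lorentzian
  field_simp
  ring

theorem abs_conjLorentzian_le (hδ : 0 < δ) (x : ℝ) : |conjLorentzian δ x| ≤ 1 / (2 * δ) := by
  have hden : 0 < δ ^ 2 + x ^ 2 := by positivity
  rw [conjLorentzian, abs_div, abs_of_pos hden, div_le_div_iff₀ hden (by positivity)]
  nlinarith [sq_nonneg (|x| - δ), sq_abs x]

theorem hasDerivAt_conjLorentzian (hδ : 0 < δ) (x : ℝ) :
    HasDerivAt (conjLorentzian δ) ((δ ^ 2 - x ^ 2) / (δ ^ 2 + x ^ 2) ^ 2) x := by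
  have hden : δ ^ 2 + x ^ 2 ≠ 0 := by positivity
  refine ((hasDerivAt_id' x).fun_div ((hasDerivAt_pow 2 x).const_add (δ ^ 2)) hden).congr_deriv ?_
  congr 1
  push_cast
  ring

theorem abs_deriv_conjLorentzian_le (hδ : 0 < δ) (x : ℝ) :
    |(δ ^ 2 - x ^ 2) / (δ ^ 2 + x ^ 2) ^ 2| ≤ δ⁻¹ * lorentzian δ x := by
  have hden : 0 < δ ^ 2 + x ^ 2 := by positivity
  have hrhs : δ⁻¹ * lorentzian δ x = (δ ^ 2 + x ^ 2) / (δ ^ 2 + x ^ 2) ^ 2 := by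
    unfold lorentzian
    field_simp
  rw [abs_div, abs_of_pos (pow_pos hden 2), hrhs]
  gcongr
  exact abs_le.2 ⟨by nlinarith [sq_nonneg δ], by nlinarith [sq_nonneg x]⟩

theorem integral_deriv_mul_lorentzian_le {f f' : ℝ → ℝ} (hf : ∀ x, HasDerivAt f (f' x) x)
    (hf' : Continuous f') (hδ : 0 < δ) (a b : ℝ) :
    ∫ x in a..b, f' x * lorentzian δ (f x) ≤ Real.pi := by
  have hcont : Continuous f := continuous_iff_continuousAt.2 fun x => (hf x).continuousAt
  have hderiv (x : ℝ) :
      HasDerivAt (fun x => Real.arctan (f x / δ)) (f' x * lorentzian δ (f x)) x := by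
    refine ((hf x).div_const δ).arctan.congr_deriv ?_
    have : δ ^ 2 + f x ^ 2 ≠ 0 := by positivity
    unfold lorentzian
    field_simp
  have := continuous_lorentzian hδ
  rw [intervalIntegral.integral_eq_sub_of_hasDerivAt (fun x _ => hderiv x)
    (Continuous.intervalIntegrable (by fun_prop) _ _)]
  linarith [Real.arctan_lt_pi_div_two (f b / δ), Real.neg_pi_div_two_lt_arctan (f a / δ)]

theorem integral_abs_deriv_conjLorentzian_comp_le {f f' : ℝ → ℝ}
    (hf : ∀ x, HasDerivAt f (f' x) x) (hf' : Continuous f') (hδ : 0 < δ) {a b : ℝ} (hab : a ≤ b)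
    (hpos : ∀ x ∈ Set.Icc a b, 0 ≤ f' x) :
    ∫ x in a..b, |(δ ^ 2 - f x ^ 2) / (δ ^ 2 + f x ^ 2) ^ 2 * f' x| ≤ Real.pi / δ := by
  have hcont : Continuous f := continuous_iff_continuousAt.2 fun x => (hf x).continuousAt
  have := continuous_lorentzian hδ
  have hderiv : Continuous fun x => (δ ^ 2 - f x ^ 2) / (δ ^ 2 + f x ^ 2) ^ 2 * f' x :=
    (Continuous.div (by fun_prop) (by fun_prop) fun x => by positivity).mul hf'
  calc _ ≤ ∫ x in a..b, δ⁻¹ * (f' x * lorentzian δ (f x)) := by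
        refine intervalIntegral.integral_mono_on hab (hderiv.abs.intervalIntegrable _ _)
          (Continuous.intervalIntegrable (by fun_prop) _ _) fun x hx => ?_
        rw [abs_mul, abs_of_nonneg (hpos x hx), mul_left_comm, mul_comm _ (f' x)]
        exact mul_le_mul_of_nonneg_left (abs_deriv_conjLorentzian_le hδ _) (hpos x hx)
    _ ≤ δ⁻¹ * Real.pi := by
        rw [intervalIntegral.integral_const_mul]
        gcongr
        exact integral_deriv_mul_lorentzian_le hf hf' hδ a b
    _ = Real.pi / δ := inv_mul_eq_div _ _

end Lorentzian

section OscillatoryIntegral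

theorem norm_integral_mul_deriv_phase_le {φ φ' ψ ψ' : ℝ → ℝ} {a b : ℝ} (hab : a ≤ b)
    (hφ : ∀ x, HasDerivAt φ (φ' x) x) (hφ' : Continuous φ')
    (hψ : ∀ x, HasDerivAt ψ (ψ' x) x) (hψ' : Continuous ψ') :
    ‖∫ x in a..b, ψ x * (Complex.exp (φ x * Complex.I) * (φ' x * Complex.I))‖ ≤
      |ψ b| + |ψ a| + ∫ x in a..b, |ψ' x| := by
  have hcφ : Continuous φ := continuous_iff_continuousAt.2 fun x => (hφ x).continuousAt
  have hnorm (c x : ℝ) : ‖(c : ℂ) * Complex.exp (φ x * Complex.I)‖ = |c| := by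
    rw [norm_mul, Complex.norm_exp_ofReal_mul_I, mul_one, Complex.norm_real, Real.norm_eq_abs]
  rw [intervalIntegral.integral_mul_deriv_eq_deriv_mul (u := fun x => (ψ x : ℂ))
    (v := fun x => Complex.exp (φ x * Complex.I)) (fun x _ => (hψ x).ofReal_comp)
    (fun x _ => ((hφ x).ofReal_comp.mul_const Complex.I).cexp)
    (Continuous.intervalIntegrable (by fun_prop) _ _)
    (Continuous.intervalIntegrable (by fun_prop) _ _)]
  refine (norm_sub_le _ _).trans (add_le_add ((norm_sub_le _ _).trans_eq ?_) ?_)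
  · rw [hnorm, hnorm]
  · exact intervalIntegral.norm_integral_le_of_norm_le hab
      (.of_forall fun x _ => (hnorm _ x).le) (hψ'.abs.intervalIntegrable _ _)

/-- Write `1 = φ' ψ + μ L` with `ψ`, `L` the conjugate Lorentzian and the Lorentzian of `φ'`, and
integrate the first part by parts; this needs no lower bound on `φ'`. -/
theorem norm_integral_exp_phase_le {φ φ' φ'' : ℝ → ℝ} (hφ : ∀ x, HasDerivAt φ (φ' x) x)
    (hφ' : ∀ x, HasDerivAt φ' (φ'' x) x) (hφ'' : Continuous φ'') {a b μ : ℝ} (hab : a ≤ b)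
    (hμ : 0 < μ) (hpos : ∀ x ∈ Set.Icc a b, 0 ≤ φ'' x) :
    ‖∫ x in a..b, Complex.exp (φ x * Complex.I)‖ ≤
      (1 + Real.pi) / μ + ∫ x in a..b, μ * lorentzian μ (φ' x) := by
  have hcφ : Continuous φ := continuous_iff_continuousAt.2 fun x => (hφ x).continuousAt
  have hcφ' : Continuous φ' := continuous_iff_continuousAt.2 fun x => (hφ' x).continuousAt
  have := continuous_lorentzian hμ
  set ψ : ℝ → ℝ := fun x => conjLorentzian μ (φ' x)
  set ψ' : ℝ → ℝ := fun x => (μ ^ 2 - φ' x ^ 2) / (μ ^ 2 + φ' x ^ 2) ^ 2 * φ'' x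
  have hψ (x : ℝ) : HasDerivAt ψ (ψ' x) x := (hasDerivAt_conjLorentzian hμ _).comp x (hφ' x)
  have hcψ : Continuous ψ := continuous_iff_continuousAt.2 fun x => (hψ x).continuousAt
  have hcψ' : Continuous ψ' :=
    (Continuous.div (by fun_prop) (by fun_prop) fun x => by positivity).mul hφ''
  have hsplit : ∫ x in a..b, Complex.exp (φ x * Complex.I) =
      -Complex.I * (∫ x in a..b, ψ x * (Complex.exp (φ x * Complex.I) * (φ' x * Complex.I))) +
        ∫ x in a..b, Complex.exp (φ x * Complex.I) * ((μ * lorentzian μ (φ' x) : ℝ) : ℂ) := by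
    rw [← intervalIntegral.integral_const_mul, ← intervalIntegral.integral_add
      (Continuous.intervalIntegrable (by fun_prop) _ _)
      (Continuous.intervalIntegrable (by fun_prop) _ _)]
    refine intervalIntegral.integral_congr fun x _ => ?_
    have hone := congrArg Complex.ofReal (mul_conjLorentzian_add_mul_lorentzian hμ (φ' x))
    push_cast at hone ⊢
    linear_combination (-Complex.exp (φ x * Complex.I)) * hone +
      Complex.exp (φ x * Complex.I) * ψ x * φ' x * Complex.I_mul_I
  have hremainder : ‖∫ x in a..b, Complex.exp (φ x * Complex.I) *
      ((μ * lorentzian μ (φ' x) : ℝ) : ℂ)‖ ≤ ∫ x in a..b, μ * lorentzian μ (φ' x) := by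
    refine intervalIntegral.norm_integral_le_of_norm_le hab (.of_forall fun x _ => ?_)
      (Continuous.intervalIntegrable (by fun_prop) _ _)
    rw [norm_mul, Complex.norm_exp_ofReal_mul_I, one_mul, Complex.norm_real,
      Real.norm_of_nonneg (mul_nonneg hμ.le (lorentzian_nonneg hμ.le _))]
  rw [hsplit]
  refine (norm_add_le _ _).trans (add_le_add ?_ hremainder)
  rw [norm_mul, norm_neg, Complex.norm_I, one_mul]
  calc _ ≤ |ψ b| + |ψ a| + ∫ x in a..b, |ψ' x| :=
        norm_integral_mul_deriv_phase_le hab hφ hcφ' hψ hcψ'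
    _ ≤ 1 / (2 * μ) + 1 / (2 * μ) + Real.pi / μ :=
        add_le_add (add_le_add (abs_conjLorentzian_le hμ _) (abs_conjLorentzian_le hμ _))
          (integral_abs_deriv_conjLorentzian_comp_le hφ' hφ'' hμ hab hpos)
    _ = (1 + Real.pi) / μ := by
        field_simp
        ring

theorem norm_integral_exp_phase_le_of_le_abs_deriv {φ φ' φ'' : ℝ → ℝ}
    (hφ : ∀ x, HasDerivAt φ (φ' x) x) (hφ' : ∀ x, HasDerivAt φ' (φ'' x) x) (hφ'' : Continuous φ'')
    {a b c M : ℝ} (hab : a ≤ b) (hc : 0 < c) (hderiv : ∀ x, c ≤ |φ' x|)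
    (hM : ∀ x, |φ'' x| ≤ M) :
    ‖∫ x in a..b, Complex.exp (φ x * Complex.I)‖ ≤ 2 / c + (b - a) * (M / c ^ 2) := by
  have hcφ' : Continuous φ' := continuous_iff_continuousAt.2 fun x => (hφ' x).continuousAt
  have hne (x : ℝ) : φ' x ≠ 0 := abs_pos.1 (hc.trans_le (hderiv x))
  have hcψ' : Continuous fun x => -φ'' x / φ' x ^ 2 :=
    hφ''.neg.div (by fun_prop) fun x => pow_ne_zero 2 (hne x)
  have hinv (x : ℝ) : |(φ' x)⁻¹| ≤ 1 / c := by
    rw [abs_inv, one_div]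
    exact inv_anti₀ hc (hderiv x)
  have hsplit : ∫ x in a..b, Complex.exp (φ x * Complex.I) = -Complex.I * ∫ x in a..b,
      ((φ' x)⁻¹ : ℝ) * (Complex.exp (φ x * Complex.I) * (φ' x * Complex.I)) := by
    rw [← intervalIntegral.integral_const_mul]
    refine intervalIntegral.integral_congr fun x _ => ?_
    have : (φ' x : ℂ) ≠ 0 := mod_cast hne x
    push_cast
    field_simp
    rw [Complex.I_sq, neg_neg]
  rw [hsplit, norm_mul, norm_neg, Complex.norm_I, one_mul]
  calc _ ≤ |(φ' b)⁻¹| + |(φ' a)⁻¹| + ∫ x in a..b, |-φ'' x / φ' x ^ 2| :=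
        norm_integral_mul_deriv_phase_le hab hφ hcφ' (fun x => (hφ' x).fun_inv (hne x)) hcψ'
    _ ≤ 1 / c + 1 / c + ∫ _ in a..b, M / c ^ 2 := by
        refine add_le_add (add_le_add (hinv b) (hinv a)) (intervalIntegral.integral_mono_on hab
          (hcψ'.abs.intervalIntegrable _ _) (by simp) fun x _ => ?_)
        rw [abs_div, abs_neg, abs_pow]
        have := hM x
        have := hderiv x
        gcongr
        exact (abs_nonneg _).trans (hM x)
    _ = 2 / c + (b - a) * (M / c ^ 2) := by
        rw [intervalIntegral.integral_const, smul_eq_mul]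
        ring

end OscillatoryIntegral

section SineLorentzian

variable {s t m μ θ : ℝ}

theorem le_cos_of_abs_lt_arccos (hs : 0 ≤ s) (hθ : |θ| < Real.arccos s) : s ≤ Real.cos θ := by
  have hs₁ : s < 1 := Real.arccos_pos.1 ((abs_nonneg θ).trans_lt hθ)
  rw [← Real.cos_abs, ← Real.cos_arccos (by linarith) hs₁.le]
  exact Real.cos_le_cos_of_nonneg_of_le_pi (abs_nonneg θ) (Real.arccos_le_pi s) hθ.le

theorem cos_le_of_arccos_le_abs (hs : 0 ≤ s) (hθ : Real.arccos s ≤ |θ|) (hθ' : |θ| ≤ Real.pi) :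
    Real.cos θ ≤ s := by
  rcases le_or_gt s 1 with h | h
  · rw [← Real.cos_abs, ← Real.cos_arccos (by linarith) h]
    exact Real.cos_le_cos_of_nonneg_of_le_pi (Real.arccos_nonneg s) hθ' hθ
  · exact (Real.cos_le_one θ).trans h.le

theorem arcsin_le_pi_div_two_mul (hs : 0 ≤ s) : Real.arcsin s ≤ Real.pi / 2 * s := by
  rcases le_or_gt s 1 with h | h
  · have := Real.mul_le_sin (Real.arcsin_nonneg.2 hs) (Real.arcsin_le_pi_div_two s)
    rw [Real.sin_arcsin (by linarith) h, div_mul_eq_mul_div, div_le_iff₀ Real.pi_pos] at this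
    linarith
  · nlinarith [Real.arcsin_le_pi_div_two s, Real.pi_pos]

theorem integral_lorentzian_mul_sin_neg_arccos_arccos_le (hs : 0 < s) (ht : 0 < t) (hμ : 0 < μ) :
    ∫ θ in -Real.arccos s..Real.arccos s, lorentzian μ (t * Real.sin θ + m) ≤
      Real.pi / (s * t) := by
  have := continuous_lorentzian hμ
  have hderiv (θ : ℝ) : HasDerivAt (fun θ => t * Real.sin θ + m) (t * Real.cos θ) θ :=
    ((Real.hasDerivAt_sin θ).const_mul t).add_const m
  rw [le_div_iff₀' (by positivity), ← intervalIntegral.integral_const_mul]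
  refine (intervalIntegral.integral_mono_on_of_le_Ioo
    (neg_le_self (Real.arccos_nonneg s)) (Continuous.intervalIntegrable (by fun_prop) _ _)
    (Continuous.intervalIntegrable (by fun_prop) _ _) fun θ hθ => ?_).trans
    (integral_deriv_mul_lorentzian_le hderiv (by fun_prop) hμ _ _)
  rw [mul_comm s t]
  gcongr
  exacts [lorentzian_nonneg hμ.le _, le_cos_of_abs_lt_arccos hs.le (abs_lt.2 hθ)]

theorem abs_sub_abs_div_two_le_abs_mul_sin_add (ht : 0 < t) (hs : s ^ 2 * t ≤ |(t - |m|)| / 2)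
    (hcos₀ : 0 ≤ Real.cos θ) (hcos : Real.cos θ ≤ s) :
    |(t - |m|)| / 2 ≤ |t * Real.sin θ + m| := by
  have hsin : 1 - s ^ 2 ≤ |Real.sin θ| := by
    nlinarith [Real.sin_sq_add_cos_sq θ, Real.abs_sin_le_one θ, abs_nonneg (Real.sin θ),
      sq_abs (Real.sin θ), mul_self_le_mul_self hcos₀ hcos]
  have hlower : |(t * |Real.sin θ| - |m|)| ≤ |t * Real.sin θ + m| := by
    have := abs_abs_sub_abs_le_abs_sub (t * Real.sin θ) (-m)
    rwa [sub_neg_eq_add, abs_neg, abs_mul, abs_of_pos ht] at this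
  have hcompare : |(t - |m|)| - |(t * |Real.sin θ| - |m|)| ≤ t * (1 - |Real.sin θ|) := by
    refine (abs_sub_abs_le_abs_sub _ _).trans_eq ?_
    rw [← abs_of_nonneg (mul_nonneg ht.le (sub_nonneg.2 (Real.abs_sin_le_one θ)))]
    ring_nf
  nlinarith

theorem integral_lorentzian_mul_sin_le_of_arccos_le_abs {a b : ℝ} (hs₀ : 0 ≤ s) (ht : 0 < t)
    (htm : t ≠ |m|) (hμ : 0 < μ) (hs : s ^ 2 * t ≤ |(t - |m|)| / 2) (hab : a ≤ b)
    (habs : ∀ θ ∈ Set.Icc a b, Real.arccos s ≤ |θ| ∧ |θ| ≤ Real.pi / 2) :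
    ∫ θ in a..b, lorentzian μ (t * Real.sin θ + m) ≤ (b - a) / |(t - |m|)| := by
  have := continuous_lorentzian hμ
  rw [div_eq_mul_inv, ← smul_eq_mul, ← intervalIntegral.integral_const]
  refine intervalIntegral.integral_mono_on hab (Continuous.intervalIntegrable (by fun_prop) _ _)
    (by simp) fun θ hθ => ?_
  obtain ⟨h₁, h₂⟩ := habs θ hθ
  have hfar : |(t - |m|)| / 2 ≤ |t * Real.sin θ + m| :=
    abs_sub_abs_div_two_le_abs_mul_sin_add ht hs
      (Real.cos_nonneg_of_neg_pi_div_two_le_of_le (abs_le.1 h₂).1 (abs_le.1 h₂).2)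
      (cos_le_of_arccos_le_abs hs₀ h₁ (by linarith [Real.pi_pos]))
  refine (lorentzian_le_inv_two_mul hμ (half_pos (abs_pos.2 (sub_ne_zero.2 htm)))
    hfar).trans_eq ?_
  rw [mul_div_cancel₀ _ two_ne_zero]

/-- The half-circle is cut at `±arccos s`: in the middle the derivative of `t sin θ + m` is at
least `s t`, and on the two sides `|t sin θ + m|` is at least `|t - |m|| / 2`. -/
theorem integral_lorentzian_mul_sin_le (ht : 0 < t) (htm : t ≠ |m|) (hμ : 0 < μ) :
    ∫ θ in -(Real.pi / 2)..Real.pi / 2, lorentzian μ (t * Real.sin θ + m) ≤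
      3 * Real.pi / 2 / √(|(t - |m|)| / 2 * t) := by
  have := continuous_lorentzian hμ
  set h := |(t - |m|)| / 2 with hh
  have : 0 < h := half_pos (abs_pos.2 (sub_ne_zero.2 htm))
  set s := √(h / t)
  have hs : 0 < s := by positivity
  have hst : s ^ 2 * t = h := by rw [Real.sq_sqrt (by positivity), div_mul_cancel₀ _ ht.ne']
  have hsqrt : √(h * t) = s * t := by
    rw [← hst, show s ^ 2 * t * t = (s * t) ^ 2 by ring, Real.sqrt_sq (by positivity)]
  set α := Real.arccos s
  have hα₀ : 0 ≤ α := Real.arccos_nonneg s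
  have hα : α ≤ Real.pi / 2 := Real.arccos_le_pi_div_two.2 hs.le
  have hside : (Real.pi / 2 - α) / |(t - |m|)| ≤ Real.pi / 4 / (s * t) := by
    have harcsin := arcsin_le_pi_div_two_mul hs.le
    rw [Real.arcsin_eq_pi_div_two_sub_arccos] at harcsin
    rw [show |(t - |m|)| = 2 * (s ^ 2 * t) by rw [hst, hh]; ring,
      div_le_div_iff₀ (by positivity) (by positivity)]
    nlinarith [mul_le_mul_of_nonneg_right harcsin (mul_pos hs ht).le]
  have hleft : ∫ θ in -(Real.pi / 2)..-α, lorentzian μ (t * Real.sin θ + m) ≤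
      (-α - -(Real.pi / 2)) / |(t - |m|)| :=
    integral_lorentzian_mul_sin_le_of_arccos_le_abs hs.le ht htm hμ hst.le (by linarith)
      fun θ hθ => by
        rw [abs_of_nonpos (by linarith [hθ.2])]
        constructor <;> linarith [hθ.1, hθ.2]
  have hright : ∫ θ in α..Real.pi / 2, lorentzian μ (t * Real.sin θ + m) ≤
      (Real.pi / 2 - α) / |(t - |m|)| :=
    integral_lorentzian_mul_sin_le_of_arccos_le_abs hs.le ht htm hμ hst.le hα
      fun θ hθ => by rwa [abs_of_nonneg (hα₀.trans hθ.1)]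
  have h_int (a b : ℝ) : IntervalIntegrable (fun θ => lorentzian μ (t * Real.sin θ + m))
    volume a b := Continuous.intervalIntegrable (by fun_prop) _ _
  rw [← intervalIntegral.integral_add_adjacent_intervals (h_int _ (-α)) (h_int _ _),
    ← intervalIntegral.integral_add_adjacent_intervals (h_int (-α) α) (h_int _ _), hsqrt]
  rw [sub_neg_eq_add, neg_add_eq_sub] at hleft
  calc _ ≤ Real.pi / 4 / (s * t) + (Real.pi / (s * t) + Real.pi / 4 / (s * t)) :=
        add_le_add (hleft.trans hside) (add_le_add
          (integral_lorentzian_mul_sin_neg_arccos_arccos_le hs ht hμ) (hright.trans hside))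
    _ = 3 * Real.pi / 2 / (s * t) := by ring

end SineLorentzian

section Bessel

/-- The part of Bessel's integral over a half-circle on which the phase is convex. -/
noncomputable def halfBessel (m t : ℝ) : ℂ :=
  ∫ θ in -(Real.pi / 2)..Real.pi / 2, Complex.exp ((m * θ - t * Real.cos θ : ℝ) * Complex.I)

theorem hasDerivAt_halfBessel_phase (m t θ : ℝ) :
    HasDerivAt (fun θ => m * θ - t * Real.cos θ) (t * Real.sin θ + m) θ := by
  refine (((hasDerivAt_id' θ).const_mul m).sub
    ((Real.hasDerivAt_cos θ).const_mul t)).congr_deriv ?_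
  ring

theorem norm_halfBessel_le {m t : ℝ} (ht : 0 < t) (htm : t ≠ |m|) :
    ‖halfBessel m t‖ ≤ 11 * (|(t - |m|)| * t) ^ (-(1 / 4) : ℝ) := by
  set X := |(t - |m|)| * t with hX
  have hX₀ : 0 < X := mul_pos (abs_pos.2 (sub_ne_zero.2 htm)) ht
  set μ := X ^ (1 / 4 : ℝ)
  have hμ : 0 < μ := by positivity
  have hsqrt : 7 / 10 * μ ^ 2 ≤ √(|(t - |m|)| / 2 * t) := by
    have : μ ^ 4 = X := by
      rw [← Real.rpow_natCast, ← Real.rpow_mul hX₀.le]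
      norm_num
    refine Real.le_sqrt_of_sq_le ?_
    linear_combination 49 / 100 * this + hX₀.le / 100 - hX / 2
  have hconvex : ∀ θ ∈ Set.Icc (-(Real.pi / 2)) (Real.pi / 2), 0 ≤ t * Real.cos θ :=
    fun θ hθ => mul_nonneg ht.le (Real.cos_nonneg_of_mem_Icc hθ)
  calc ‖halfBessel m t‖
      ≤ (1 + Real.pi) / μ + ∫ θ in -(Real.pi / 2)..Real.pi / 2,
          μ * lorentzian μ (t * Real.sin θ + m) :=
        norm_integral_exp_phase_le (hasDerivAt_halfBessel_phase m t)
          (fun θ => ((Real.hasDerivAt_sin θ).const_mul t).add_const m) (by fun_prop)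
          (by linarith [Real.pi_pos]) hμ hconvex
    _ ≤ (1 + Real.pi) / μ + μ * (3 * Real.pi / 2 / (7 / 10 * μ ^ 2)) := by
        rw [intervalIntegral.integral_const_mul]
        gcongr
        refine (integral_lorentzian_mul_sin_le ht htm hμ).trans ?_
        gcongr
    _ ≤ 11 * X ^ (-(1 / 4) : ℝ) := by
        rw [Real.rpow_neg hX₀.le, ← div_eq_mul_inv, show (1 + Real.pi) / μ +
          μ * (3 * Real.pi / 2 / (7 / 10 * μ ^ 2)) = (1 + 22 / 7 * Real.pi) / μ by field_simp; ring]
        gcongr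
        linarith [Real.pi_lt_d2]

theorem norm_halfBessel_le_div_abs {m t : ℝ} (ht : 0 < t) (htm : t ≤ |m| / 2) :
    ‖halfBessel m t‖ ≤ 11 / |m| := by
  have hm : 0 < |m| := by linarith
  have hfar (θ : ℝ) : |m| / 2 ≤ |t * Real.sin θ + m| := by
    have hsin : |t * Real.sin θ| ≤ t := by
      rw [abs_mul, abs_of_pos ht]
      exact mul_le_of_le_one_right ht.le (Real.abs_sin_le_one θ)
    have := abs_sub_abs_le_abs_sub m (-(t * Real.sin θ))
    rw [abs_neg, sub_neg_eq_add, add_comm] at this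
    linarith
  have hcos (θ : ℝ) : |t * Real.cos θ| ≤ |m| / 2 := by
    rw [abs_mul, abs_of_pos ht]
    exact (mul_le_of_le_one_right ht.le (Real.abs_cos_le_one θ)).trans htm
  calc ‖halfBessel m t‖
      ≤ 2 / (|m| / 2) + (Real.pi / 2 - -(Real.pi / 2)) * (|m| / 2 / (|m| / 2) ^ 2) :=
        norm_integral_exp_phase_le_of_le_abs_deriv (hasDerivAt_halfBessel_phase m t)
          (fun θ => ((Real.hasDerivAt_sin θ).const_mul t).add_const m) (by fun_prop)
          (by linarith [Real.pi_pos]) (half_pos hm) hfar hcos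
    _ = (4 + 2 * Real.pi) / |m| := by
        field_simp
        ring
    _ ≤ 11 / |m| := by
        gcongr
        linarith [Real.pi_lt_d2]

theorem cosTwoPi_coe (x : ℝ) : cosTwoPi (x : UnitAddCircle) = Real.cos (2 * Real.pi * x) := rfl

@[fun_prop]
theorem continuous_cosTwoPi : Continuous cosTwoPi :=
  continuous_coinduced_dom.2 (by
    change Continuous fun x : ℝ => Real.cos (2 * Real.pi * x)
    fun_prop)

theorem cosTwoPi_le_one (x : UnitAddCircle) : cosTwoPi x ≤ 1 := by
  induction x using QuotientAddGroup.induction_on with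
  | H x => exact Real.cos_le_one _

theorem neg_one_le_cosTwoPi (x : UnitAddCircle) : -1 ≤ cosTwoPi x := by
  induction x using QuotientAddGroup.induction_on with
  | H x => exact Real.neg_one_le_cos _

theorem cosTwoPi_neg (x : UnitAddCircle) : cosTwoPi (-x) = cosTwoPi x := by
  induction x using QuotientAddGroup.induction_on with
  | H x =>
    change Real.cos (2 * Real.pi * -x) = Real.cos (2 * Real.pi * x)
    rw [mul_neg, Real.cos_neg]

/-- The Bessel coefficients `iᵐ Jₘ(t)`: the Fourier coefficients of `x ↦ exp (i t cos (2 π x))`. -/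
noncomputable def besselCoeff (m : ℤ) (t : ℝ) : ℂ :=
  fourierCoeff (fun x : UnitAddCircle => Complex.exp ((t * cosTwoPi x : ℝ) * Complex.I)) m

theorem norm_besselCoeff_le_one (m : ℤ) (t : ℝ) : ‖besselCoeff m t‖ ≤ 1 := by
  refine (norm_integral_le_of_norm_le_const (C := 1) (.of_forall fun x => ?_)).trans_eq (by simp)
  rw [norm_smul, fourier_apply, Circle.norm_coe, Complex.norm_exp_ofReal_mul_I, one_mul]

theorem besselCoeff_eq_intervalIntegral (m : ℤ) (t : ℝ) :
    besselCoeff m t = ((2 * Real.pi)⁻¹ : ℝ) • ∫ θ in -(Real.pi / 2)..3 * Real.pi / 2,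
      Complex.exp ((t * Real.cos θ - m * θ : ℝ) * Complex.I) := by
  have hscale := intervalIntegral.integral_comp_mul_left (a := -1 / 4) (b := -1 / 4 + 1)
    (fun θ : ℝ => Complex.exp ((t * Real.cos θ - m * θ : ℝ) * Complex.I))
    Real.two_pi_pos.ne'
  rw [show 2 * Real.pi * (-1 / 4) = -(Real.pi / 2) by ring,
    show 2 * Real.pi * (-1 / 4 + 1) = 3 * Real.pi / 2 by ring] at hscale
  rw [besselCoeff, fourierCoeff_eq_intervalIntegral _ m (-1 / 4), ← hscale, div_one, one_smul]
  refine intervalIntegral.integral_congr fun x _ => ?_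
  simp only [fourier_coe_apply, cosTwoPi_coe, smul_eq_mul, ← Complex.exp_add]
  congr 1
  push_cast
  ring

theorem integral_exp_mul_cos_sub_eq_conj_halfBessel (m t : ℝ) :
    ∫ θ in -(Real.pi / 2)..Real.pi / 2, Complex.exp ((t * Real.cos θ - m * θ : ℝ) * Complex.I) =
      conj (halfBessel m t) := by
  rw [halfBessel, ← intervalIntegral.intervalIntegral_conj]
  refine intervalIntegral.integral_congr fun θ _ => ?_
  simp only [← Complex.exp_conj, map_mul, Complex.conj_ofReal, Complex.conj_I]
  push_cast
  ring_nf

theorem integral_exp_mul_cos_sub_eq_exp_mul_halfBessel (m t : ℝ) :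
    ∫ θ in Real.pi / 2..3 * Real.pi / 2, Complex.exp ((t * Real.cos θ - m * θ : ℝ) * Complex.I) =
      Complex.exp ((-(m * Real.pi) : ℝ) * Complex.I) * halfBessel (-m) t := by
  rw [halfBessel, ← intervalIntegral.integral_const_mul,
    show Real.pi / 2 = -(Real.pi / 2) + Real.pi by ring,
    show 3 * Real.pi / 2 = Real.pi / 2 + Real.pi by ring,
    ← intervalIntegral.integral_comp_add_right
      (fun θ : ℝ => Complex.exp ((t * Real.cos θ - m * θ : ℝ) * Complex.I))]
  ring_nf
  refine intervalIntegral.integral_congr fun θ _ => ?_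
  simp only [Real.cos_add_pi, ← Complex.exp_add]
  congr 1
  push_cast
  ring

theorem norm_besselCoeff_le_halfBessel (m : ℤ) (t : ℝ) :
    ‖besselCoeff m t‖ ≤ (2 * Real.pi)⁻¹ * (‖halfBessel m t‖ + ‖halfBessel (-m) t‖) := by
  have h_int (a b : ℝ) : IntervalIntegrable
      (fun θ : ℝ => Complex.exp ((t * Real.cos θ - m * θ : ℝ) * Complex.I)) volume a b :=
    Continuous.intervalIntegrable (by fun_prop) _ _
  rw [besselCoeff_eq_intervalIntegral, ← intervalIntegral.integral_add_adjacent_intervals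
    (h_int _ (Real.pi / 2)) (h_int _ _), integral_exp_mul_cos_sub_eq_conj_halfBessel,
    integral_exp_mul_cos_sub_eq_exp_mul_halfBessel, norm_smul,
    Real.norm_of_nonneg (by positivity)]
  gcongr
  refine (norm_add_le _ _).trans_eq ?_
  rw [Complex.norm_conj, norm_mul, Complex.norm_exp_ofReal_mul_I, one_mul]

theorem norm_besselCoeff_le_four_mul {m : ℤ} {t X : ℝ} (hX : 0 ≤ X)
    (h₁ : ‖halfBessel m t‖ ≤ 11 * X) (h₂ : ‖halfBessel (-m) t‖ ≤ 11 * X) :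
    ‖besselCoeff m t‖ ≤ 4 * X := by
  refine (norm_besselCoeff_le_halfBessel m t).trans ?_
  rw [inv_mul_le_iff₀ Real.two_pi_pos]
  nlinarith [Real.pi_gt_three]

theorem norm_besselCoeff_le_rpow {m : ℤ} {t : ℝ} (ht : 0 < t) (htm : t ≠ |(m : ℝ)|) :
    ‖besselCoeff m t‖ ≤ 4 * (|(t - |(m : ℝ)|)| * t) ^ (-(1 / 4) : ℝ) :=
  norm_besselCoeff_le_four_mul (by positivity) (norm_halfBessel_le ht htm)
    (by simpa only [abs_neg] using norm_halfBessel_le (m := -m) ht (by rwa [abs_neg]))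

theorem norm_besselCoeff_le_div {m : ℤ} {t : ℝ} (ht : 0 < t) (htm : t ≤ (1 + |(m : ℝ)|) / 4) :
    ‖besselCoeff m t‖ ≤ 8 / (1 + |(m : ℝ)|) := by
  rcases eq_or_ne m 0 with rfl | hm
  · refine (norm_besselCoeff_le_one 0 t).trans ?_
    norm_num
  · have hm₁ : 1 ≤ |(m : ℝ)| := mod_cast Int.one_le_abs hm
    have hle : t ≤ |(m : ℝ)| / 2 := by linarith
    have hbessel : ‖besselCoeff m t‖ ≤ 4 * (1 / |(m : ℝ)|) := by
      refine norm_besselCoeff_le_four_mul (by positivity) ?_ ?_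
      · rw [mul_one_div]
        exact norm_halfBessel_le_div_abs ht hle
      · rw [mul_one_div, ← abs_neg]
        exact norm_halfBessel_le_div_abs ht (by rwa [abs_neg])
    refine hbessel.trans ?_
    rw [mul_one_div, div_le_div_iff₀ (by positivity) (by positivity)]
    linarith

end Bessel

section PowerKernels

theorem lintegral_comp_abs (f : ℝ → ℝ≥0∞) : ∫⁻ u, f |u| = 2 * ∫⁻ u in Set.Ioi 0, f u := by
  have hpos : ∫⁻ u in Set.Ioi (0 : ℝ), f |u| = ∫⁻ u in Set.Ioi 0, f u :=
    setLIntegral_congr_fun measurableSet_Ioi fun u hu => congrArg f (abs_of_pos hu)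
  have hneg : ∫⁻ u in Set.Iio (0 : ℝ), f |u| = ∫⁻ u in Set.Ioi 0, f |u| := by
    have := (Measure.measurePreserving_neg (volume : Measure ℝ)).setLIntegral_comp_preimage_emb
      (MeasurableEquiv.neg ℝ).measurableEmbedding (fun u => f |u|) (Set.Ioi 0)
    simpa only [abs_neg, Set.neg_preimage, Set.neg_Ioi, neg_zero] using this
  rw [← lintegral_add_compl _ measurableSet_Ioi, Set.compl_Ioi, ← restrict_Iio_eq_restrict_Iic,
    hneg, hpos, two_mul]

theorem setLIntegral_Ioc_rpow {s R : ℝ} (hs : s < 1) (hR : 0 ≤ R) :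
    ∫⁻ u in Set.Ioc 0 R, ENNReal.ofReal (u ^ (-s)) = ENNReal.ofReal (R ^ (1 - s) / (1 - s)) := by
  have h_int : IntegrableOn (fun u : ℝ => u ^ (-s)) (Set.Ioc 0 R) :=
    (intervalIntegrable_iff_integrableOn_Ioc_of_le hR).1
      (intervalIntegral.intervalIntegrable_rpow' (by linarith))
  rw [← ofReal_integral_eq_lintegral_ofReal h_int
    (ae_restrict_of_forall_mem measurableSet_Ioc fun u hu => Real.rpow_nonneg hu.1.le _),
    ← intervalIntegral.integral_of_le hR, integral_rpow (.inl (by linarith)),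
    show -s + 1 = 1 - s by ring, Real.zero_rpow (by linarith), sub_zero]

theorem setLIntegral_Ioi_rpow {s R : ℝ} (hs : 1 < s) (hR : 0 < R) :
    ∫⁻ u in Set.Ioi R, ENNReal.ofReal (u ^ (-s)) = ENNReal.ofReal (R ^ (1 - s) / (s - 1)) := by
  rw [← ofReal_integral_eq_lintegral_ofReal (integrableOn_Ioi_rpow_of_lt (by linarith) hR)
    (ae_restrict_of_forall_mem measurableSet_Ioi fun u hu =>
      Real.rpow_nonneg (hR.trans hu).le _), integral_Ioi_rpow_of_lt (by linarith) hR,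
    show -s + 1 = 1 - s by ring, neg_div, ← div_neg, neg_sub]

theorem lintegral_rpow_abs_mul_max {s R : ℝ} (hs : 1 / 2 < s) (hs' : s < 1) (hR : 0 < R) :
    ∫⁻ u : ℝ, ENNReal.ofReal ((|u| * max R |u|) ^ (-s)) =
      ENNReal.ofReal (2 * (1 / (1 - s) + 1 / (2 * s - 1)) * R ^ (1 - 2 * s)) := by
  have : 0 < 1 - s := by linarith
  have : 0 < 2 * s - 1 := by linarith
  have hnear : ∫⁻ u in Set.Ioc 0 R, ENNReal.ofReal ((u * max R u) ^ (-s)) =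
      ENNReal.ofReal (1 / (1 - s) * R ^ (1 - 2 * s)) := by
    have (u : ℝ) (hu : u ∈ Set.Ioc 0 R) : ENNReal.ofReal ((u * max R u) ^ (-s)) =
        ENNReal.ofReal (R ^ (-s)) * ENNReal.ofReal (u ^ (-s)) := by
      rw [max_eq_left hu.2, mul_comm, Real.mul_rpow hR.le hu.1.le,
        ENNReal.ofReal_mul (by positivity)]
    rw [setLIntegral_congr_fun measurableSet_Ioc this, lintegral_const_mul' _ _ (by simp),
      setLIntegral_Ioc_rpow hs' hR.le, ← ENNReal.ofReal_mul (by positivity),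
      show 1 - 2 * s = -s + (1 - s) by ring, Real.rpow_add hR]
    ring_nf
  have hfar : ∫⁻ u in Set.Ioi R, ENNReal.ofReal ((u * max R u) ^ (-s)) =
      ENNReal.ofReal (1 / (2 * s - 1) * R ^ (1 - 2 * s)) := by
    have (u : ℝ) (hu : u ∈ Set.Ioi R) : ENNReal.ofReal ((u * max R u) ^ (-s)) =
        ENNReal.ofReal (u ^ (-(2 * s))) := by
      have hu₀ : 0 < u := hR.trans hu
      rw [max_eq_right (le_of_lt hu), Real.mul_rpow hu₀.le hu₀.le, ← Real.rpow_add hu₀]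
      ring_nf
    rw [setLIntegral_congr_fun measurableSet_Ioi this,
      setLIntegral_Ioi_rpow (by linarith) hR, one_div_mul_eq_div]
  rw [lintegral_comp_abs fun u => ENNReal.ofReal ((u * max R u) ^ (-s)),
    ← Set.Ioc_union_Ioi_eq_Ioi hR.le, lintegral_union measurableSet_Ioi Set.Ioc_disjoint_Ioi_same,
    hnear, hfar, ← ENNReal.ofReal_add (by positivity) (by positivity), ← add_mul, mul_assoc,
    ENNReal.ofReal_mul zero_le_two, ENNReal.ofReal_ofNat]

theorem rpow_neg_abs_sub_mul_le {s R t : ℝ} (hs : 0 < s) (hR : 0 < R) (hRt : R < t) (c : ℝ) :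
    (|t - c| * t) ^ (-s) ≤ (|t - c| * max R |t - c|) ^ (-s) + (|t| * max R |t|) ^ (-s) := by
  have ht : 0 < t := hR.trans hRt
  rcases eq_or_ne t c with rfl | hne
  · rw [sub_self, abs_zero, zero_mul, Real.zero_rpow (by linarith)]
    positivity
  have : 0 < |t - c| := abs_pos.2 (sub_ne_zero.2 hne)
  rcases le_total |t - c| t with h | h
  · refine le_add_of_le_of_nonneg (Real.rpow_le_rpow_of_nonpos (by positivity) ?_ (by linarith))
      (by positivity)
    gcongr
    exact max_le hRt.le h
  · refine le_add_of_nonneg_of_le (by positivity)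
      (Real.rpow_le_rpow_of_nonpos (by positivity) ?_ (by linarith))
    rw [abs_of_pos ht, max_eq_right hRt.le]
    gcongr

theorem setLIntegral_Ioi_rpow_abs_sub_mul_le {s R : ℝ} (hs : 1 / 2 < s) (hs' : s < 1)
    (hR : 0 < R) (c : ℝ) :
    ∫⁻ t in Set.Ioi R, ENNReal.ofReal ((|t - c| * t) ^ (-s)) ≤
      ENNReal.ofReal (4 * (1 / (1 - s) + 1 / (2 * s - 1)) * R ^ (1 - 2 * s)) := by
  set k : ℝ → ℝ≥0∞ := fun u => ENNReal.ofReal ((|u| * max R |u|) ^ (-s))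
  have : 0 < 1 - s := by linarith
  have : 0 < 2 * s - 1 := by linarith
  calc ∫⁻ t in Set.Ioi R, ENNReal.ofReal ((|t - c| * t) ^ (-s))
      ≤ ∫⁻ t in Set.Ioi R, (k (t - c) + k t) := by
        refine setLIntegral_mono' measurableSet_Ioi fun t ht => ?_
        rw [← ENNReal.ofReal_add (by positivity) (by positivity)]
        exact ENNReal.ofReal_le_ofReal (rpow_neg_abs_sub_mul_le (by linarith) hR ht c)
    _ ≤ ∫⁻ t, (k (t - c) + k t) := setLIntegral_le_lintegral _ _
    _ = (∫⁻ t, k t) + ∫⁻ t, k t := by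
        rw [lintegral_add_right _ (by fun_prop), lintegral_sub_right_eq_self k c]
    _ = _ := by
        rw [lintegral_rpow_abs_mul_max hs hs' hR, ← ENNReal.ofReal_add (by positivity)
          (by positivity)]
        ring_nf

theorem setLIntegral_Ioc_rpow_abs_sub_le {s R : ℝ} (hs : 0 < s) (hs' : s < 1) (hR : 0 < R)
    (c : ℝ) :
    ∫⁻ t in Set.Ioc 0 R, ENNReal.ofReal (|t - c| ^ (-s)) ≤
      ENNReal.ofReal ((1 + 2 / (1 - s)) * R ^ (1 - s)) := by
  have : 0 < 1 - s := by linarith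
  set k : ℝ → ℝ≥0∞ := (Set.Ioc 0 R).indicator fun u => ENNReal.ofReal (u ^ (-s))
  have hle (t : ℝ) : ENNReal.ofReal (|t - c| ^ (-s)) ≤ k |t - c| + ENNReal.ofReal (R ^ (-s)) := by
    rcases (abs_nonneg (t - c)).eq_or_lt with h₀ | h₀
    · rw [← h₀, Real.zero_rpow (by linarith), ENNReal.ofReal_zero]
      exact zero_le
    rcases le_or_gt |t - c| R with h | h
    · exact le_add_of_le_of_nonneg (Set.indicator_of_mem (Set.mem_Ioc.2 ⟨h₀, h⟩)
        fun u : ℝ => ENNReal.ofReal (u ^ (-s))).ge zero_le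
    · exact le_add_of_nonneg_of_le zero_le
        (ENNReal.ofReal_le_ofReal (Real.rpow_le_rpow_of_nonpos hR h.le (by linarith)))
  calc ∫⁻ t in Set.Ioc 0 R, ENNReal.ofReal (|t - c| ^ (-s))
      ≤ ∫⁻ t in Set.Ioc 0 R, (k |t - c| + ENNReal.ofReal (R ^ (-s))) := lintegral_mono hle
    _ ≤ (∫⁻ t, k |t - c|) + ENNReal.ofReal (R ^ (-s)) * ENNReal.ofReal R := by
        rw [lintegral_add_right _ measurable_const, setLIntegral_const, Real.volume_Ioc, sub_zero]
        gcongr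
        exact Measure.restrict_le_self
    _ = 2 * ENNReal.ofReal (R ^ (1 - s) / (1 - s)) + ENNReal.ofReal (R ^ (1 - s)) := by
        rw [lintegral_sub_right_eq_self (fun u => k |u|) c, lintegral_comp_abs,
          setLIntegral_indicator measurableSet_Ioc, Set.inter_eq_left.2 Set.Ioc_subset_Ioi_self,
          setLIntegral_Ioc_rpow hs' hR.le, ← ENNReal.ofReal_mul (by positivity),
          sub_eq_neg_add 1 s, Real.rpow_add_one hR.ne']
    _ = _ := by
        rw [← ENNReal.ofReal_ofNat 2, ← ENNReal.ofReal_mul zero_le_two,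
          ← ENNReal.ofReal_add (by positivity) (by positivity)]
        ring_nf

end PowerKernels

section BesselProduct

theorem prod_le_sum_pow_card {ι : Type*} [Fintype ι] [Nonempty ι] {x : ι → ℝ}
    (hx : ∀ i, 0 ≤ x i) : ∏ i, x i ≤ ∑ i, x i ^ Fintype.card ι := by
  obtain ⟨i, -, hi⟩ := Finset.exists_max_image Finset.univ x Finset.univ_nonempty
  calc ∏ k, x k ≤ ∏ _k : ι, x i :=
        Finset.prod_le_prod (fun k _ => hx k) fun k _ => hi k (Finset.mem_univ k)
    _ = x i ^ Fintype.card ι := by rw [Finset.prod_const, Finset.card_univ]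
    _ ≤ ∑ i, x i ^ Fintype.card ι :=
        Finset.single_le_sum (f := fun i => x i ^ Fintype.card ι)
          (fun k _ => pow_nonneg (hx k) _) (Finset.mem_univ i)

theorem prod_le_mul_of_le_one {ι : Type*} [Fintype ι] {x : ι → ℝ} (hx₀ : ∀ i, 0 ≤ x i)
    (hx₁ : ∀ i, x i ≤ 1) {i j : ι} (hij : i ≠ j) : ∏ k, x k ≤ x i * x j := by
  classical
  rw [← Finset.mul_prod_erase _ x (Finset.mem_univ i),
    ← Finset.mul_prod_erase _ x (Finset.mem_erase.2 ⟨hij.symm, Finset.mem_univ j⟩)]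
  exact mul_le_mul_of_nonneg_left (mul_le_of_le_one_right (hx₀ j)
    (Finset.prod_le_one (fun k _ => hx₀ k) fun k _ => hx₁ k)) (hx₀ i)

theorem mul_rpow_le_rpow_two_mul_add {a b : ℝ} (ha : 0 ≤ a) (hb : 0 ≤ b) (r : ℝ) :
    (a * b) ^ r ≤ a ^ (2 * r) + b ^ (2 * r) := by
  have hsq {x : ℝ} (hx : 0 ≤ x) : x ^ (2 * r) = (x ^ r) ^ 2 := by
    rw [mul_comm, Real.rpow_mul hx, Real.rpow_two]
  rw [Real.mul_rpow ha hb, hsq ha, hsq hb]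
  nlinarith [sq_nonneg (a ^ r - b ^ r), sq_nonneg (a ^ r), sq_nonneg (b ^ r)]

theorem setLIntegral_Ioc_rpow_abs_sub_mul_le {R : ℝ} (hR : 0 < R) (c : ℝ) :
    ∫⁻ t in Set.Ioc 0 R, ENNReal.ofReal ((|t - c| * t) ^ (-(1 / 4) : ℝ)) ≤
      ENNReal.ofReal (10 * √R) := by
  have hbound (c : ℝ) : ∫⁻ t in Set.Ioc 0 R, ENNReal.ofReal (|t - c| ^ (-(1 / 2) : ℝ)) ≤
      ENNReal.ofReal (5 * √R) := by
    refine (setLIntegral_Ioc_rpow_abs_sub_le (by norm_num) (by norm_num) hR c).trans_eq ?_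
    rw [Real.sqrt_eq_rpow]
    norm_num
  calc _ ≤ ∫⁻ t in Set.Ioc 0 R, (ENNReal.ofReal (|t - c| ^ (-(1 / 2) : ℝ)) +
        ENNReal.ofReal (|t - 0| ^ (-(1 / 2) : ℝ))) := by
        refine setLIntegral_mono' measurableSet_Ioc fun t ht => ?_
        rw [← ENNReal.ofReal_add (by positivity) (by positivity), sub_zero, abs_of_pos ht.1]
        refine ENNReal.ofReal_le_ofReal
          ((mul_rpow_le_rpow_two_mul_add (abs_nonneg _) ht.1.le _).trans_eq ?_)
        norm_num
    _ ≤ ENNReal.ofReal (5 * √R) + ENNReal.ofReal (5 * √R) := by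
        rw [lintegral_add_right _ (by fun_prop)]
        exact add_le_add (hbound c) (hbound 0)
    _ = ENNReal.ofReal (10 * √R) := by
        rw [← ENNReal.ofReal_add (by positivity) (by positivity)]
        ring_nf

theorem setLIntegral_Ioc_prod_besselCoeff_le (n : Fin 3 → ℤ) {i j : Fin 3} (hij : j ≠ i) {R : ℝ}
    (hR : R = (1 + |(n j : ℝ)|) / 4) :
    ∫⁻ t in Set.Ioc 0 R, ENNReal.ofReal (∏ k, ‖besselCoeff (n k) t‖) ≤
      ENNReal.ofReal (80 / √R) := by
  have hR₀ : 0 < R := by rw [hR]; positivity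
  have hpointwise (t : ℝ) (ht : t ∈ Set.Ioc 0 R) (htn : t ≠ |(n i : ℝ)|) :
      ∏ k, ‖besselCoeff (n k) t‖ ≤ 8 / R * (|(t - |(n i : ℝ)|)| * t) ^ (-(1 / 4) : ℝ) := by
    calc ∏ k, ‖besselCoeff (n k) t‖ ≤ ‖besselCoeff (n j) t‖ * ‖besselCoeff (n i) t‖ :=
          prod_le_mul_of_le_one (fun k => norm_nonneg _)
            (fun k => norm_besselCoeff_le_one (n k) t) hij
      _ ≤ 8 / (1 + |(n j : ℝ)|) * (4 * (|(t - |(n i : ℝ)|)| * t) ^ (-(1 / 4) : ℝ)) :=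
          mul_le_mul (norm_besselCoeff_le_div ht.1 (ht.2.trans_eq hR))
            (norm_besselCoeff_le_rpow ht.1 htn) (norm_nonneg _) (by positivity)
      _ = 8 / R * (|(t - |(n i : ℝ)|)| * t) ^ (-(1 / 4) : ℝ) := by
          rw [hR]
          field_simp
  calc _ ≤ ∫⁻ t in Set.Ioc 0 R, ENNReal.ofReal (8 / R) *
        ENNReal.ofReal ((|(t - |(n i : ℝ)|)| * t) ^ (-(1 / 4) : ℝ)) := by
        refine setLIntegral_mono_ae' measurableSet_Ioc ?_
        filter_upwards [volume.ae_ne |(n i : ℝ)|] with t htn ht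
        rw [← ENNReal.ofReal_mul (by positivity)]
        exact ENNReal.ofReal_le_ofReal (hpointwise t ht htn)
    _ ≤ ENNReal.ofReal (8 / R) * ENNReal.ofReal (10 * √R) := by
        rw [lintegral_const_mul' _ _ ENNReal.ofReal_ne_top]
        gcongr
        exact setLIntegral_Ioc_rpow_abs_sub_mul_le hR₀ _
    _ = ENNReal.ofReal (80 / √R) := by
        rw [← ENNReal.ofReal_mul (by positivity)]
        congr 1
        field_simp
        rw [Real.sq_sqrt hR₀.le]
        ring

theorem setLIntegral_Ioi_prod_besselCoeff_le (n : Fin 3 → ℤ) {R : ℝ} (hR : 0 < R) :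
    ∫⁻ t in Set.Ioi R, ENNReal.ofReal (∏ k, ‖besselCoeff (n k) t‖) ≤
      ENNReal.ofReal (4608 / √R) := by
  have hpointwise (t : ℝ) (ht : 0 < t) (htn : ∀ k, t ≠ |(n k : ℝ)|) :
      ∏ k, ‖besselCoeff (n k) t‖ ≤
        ∑ k, 64 * (|(t - |(n k : ℝ)|)| * t) ^ (-(3 / 4) : ℝ) := by
    refine (prod_le_sum_pow_card fun k => norm_nonneg _).trans (Finset.sum_le_sum fun k _ => ?_)
    rw [Fintype.card_fin]
    calc ‖besselCoeff (n k) t‖ ^ 3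
        ≤ (4 * (|(t - |(n k : ℝ)|)| * t) ^ (-(1 / 4) : ℝ)) ^ 3 := by
          gcongr
          exact norm_besselCoeff_le_rpow ht (htn k)
      _ = 64 * (|(t - |(n k : ℝ)|)| * t) ^ (-(3 / 4) : ℝ) := by
          rw [mul_pow, ← Real.rpow_mul_natCast (by positivity)]
          norm_num
  calc _ ≤ ∫⁻ t in Set.Ioi R, ∑ k, ENNReal.ofReal 64 *
        ENNReal.ofReal ((|(t - |(n k : ℝ)|)| * t) ^ (-(3 / 4) : ℝ)) := by
        refine setLIntegral_mono_ae' measurableSet_Ioi ?_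
        filter_upwards [ae_all_iff.2 fun k => volume.ae_ne |(n k : ℝ)|] with t htn ht
        have ht₀ : 0 < t := hR.trans ht
        simp only [← ENNReal.ofReal_mul (show (0 : ℝ) ≤ 64 by norm_num)]
        rw [← ENNReal.ofReal_sum_of_nonneg fun k _ => by positivity]
        exact ENNReal.ofReal_le_ofReal (hpointwise t ht₀ htn)
    _ ≤ ∑ _k : Fin 3, ENNReal.ofReal 64 * ENNReal.ofReal (24 / √R) := by
        rw [lintegral_finsetSum _ fun k _ => by fun_prop]
        gcongr with k
        rw [lintegral_const_mul' _ _ ENNReal.ofReal_ne_top]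
        gcongr
        refine (setLIntegral_Ioi_rpow_abs_sub_mul_le (by norm_num) (by norm_num) hR _).trans_eq ?_
        rw [Real.sqrt_eq_rpow, div_eq_mul_inv 24, ← Real.rpow_neg hR.le]
        norm_num
    _ = ENNReal.ofReal (4608 / √R) := by
        simp only [Finset.sum_const, Finset.card_univ, Fintype.card_fin, nsmul_eq_mul]
        rw [← ENNReal.ofReal_mul (by norm_num), ← ENNReal.ofReal_natCast,
          ← ENNReal.ofReal_mul (by norm_num)]
        ring_nf

theorem setLIntegral_prod_besselCoeff_le (n : Fin 3 → ℤ) (j : Fin 3) :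
    ∫⁻ t in Set.Ioi 0, ENNReal.ofReal (∏ k, ‖besselCoeff (n k) t‖) ≤
      ENNReal.ofReal (10 ^ 4 / √(1 + |(n j : ℝ)|)) := by
  set R := (1 + |(n j : ℝ)|) / 4 with hR
  have hR₀ : 0 < R := by positivity
  have hsqrt : √(1 + |(n j : ℝ)|) = 2 * √R := by
    rw [show 1 + |(n j : ℝ)| = 2 ^ 2 * R by rw [hR]; ring, Real.sqrt_mul (by norm_num),
      Real.sqrt_sq zero_le_two]
  obtain ⟨i, hij⟩ := exists_ne j
  rw [← Set.Ioc_union_Ioi_eq_Ioi hR₀.le,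
    lintegral_union measurableSet_Ioi Set.Ioc_disjoint_Ioi_same, hsqrt]
  refine (add_le_add (setLIntegral_Ioc_prod_besselCoeff_le n hij.symm hR)
    (setLIntegral_Ioi_prod_besselCoeff_le n hR₀)).trans ?_
  rw [← ENNReal.ofReal_add (by positivity) (by positivity), ← add_div]
  refine ENNReal.ofReal_le_ofReal ?_
  rw [div_le_div_iff₀ (by positivity) (by positivity)]
  nlinarith [Real.sqrt_nonneg R]

end BesselProduct

section TorusFourier

variable {d : Type*} [Fintype d]

theorem volume_unitAddTorus :
    (volume : Measure (UnitAddTorus d)) = Measure.pi fun _ => AddCircle.haarAddCircle := by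
  rw [volume_pi, AddCircle.volume_eq_smul_haarAddCircle, ENNReal.ofReal_one, one_smul]

-- `mFourierCoeff` integrates against the Haar probability measure, which is propositionally but
-- not definitionally equal to `volume`.
theorem mFourierCoeff_eq_integral_volume (f : UnitAddTorus d → ℂ) (n : d → ℤ) :
    mFourierCoeff f n = ∫ k, mFourier (-n) k * f k := by
  rw [volume_unitAddTorus]
  rfl

theorem hasSum_conj_mFourierCoeff_mul {f g : UnitAddTorus d → ℂ} (hf : Continuous f)
    (hg : Continuous g) :
    HasSum (fun n => conj (mFourierCoeff f n) * mFourierCoeff g n) (∫ k, conj (f k) * g k) := by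
  rw [volume_unitAddTorus]
  let _ : MeasureSpace UnitAddCircle := ⟨AddCircle.haarAddCircle⟩
  have : IsProbabilityMeasure (volume : Measure UnitAddCircle) :=
    inferInstanceAs (IsProbabilityMeasure AddCircle.haarAddCircle)
  let F : C(UnitAddTorus d, ℂ) := ⟨f, hf⟩
  let G : C(UnitAddTorus d, ℂ) := ⟨g, hg⟩
  have hparseval := hasSum_prod_mFourierCoeff (F.toLp 2 volume ℂ) (G.toLp 2 volume ℂ)
  simp only [mFourierCoeff_toLp] at hparseval
  convert! hparseval using 1
  refine integral_congr_ae ?_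
  filter_upwards [F.coeFn_toLp (p := 2) (𝕜 := ℂ) volume,
    G.coeFn_toLp (p := 2) (𝕜 := ℂ) volume] with k hF hG
  rw [hF, hG]
  rfl

theorem hasSum_norm_sq_mFourierCoeff {f : UnitAddTorus d → ℂ} (hf : Continuous f) :
    HasSum (fun n => ‖mFourierCoeff f n‖ ^ 2) (∫ k, ‖f k‖ ^ 2) := by
  have hparseval := hasSum_conj_mFourierCoeff_mul hf hf
  simp only [Complex.conj_mul', ← Complex.ofReal_pow] at hparseval
  rw [integral_complex_ofReal] at hparseval
  exact Complex.hasSum_ofReal.1 hparseval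

theorem mFourierCoeff_conj (f : UnitAddTorus d → ℂ) (n : d → ℤ) :
    mFourierCoeff (fun k => conj (f k)) n = conj (mFourierCoeff f (-n)) := by
  simp only [mFourierCoeff_eq_integral_volume, ← integral_conj, map_mul, ← mFourier_neg,
    neg_neg]

theorem hasSum_mFourierCoeff_neg_mul {f g : UnitAddTorus d → ℂ} (hf : Continuous f)
    (hg : Continuous g) :
    HasSum (fun n => mFourierCoeff f (-n) * mFourierCoeff g n) (∫ k, f k * g k) := by
  simpa only [mFourierCoeff_conj, Complex.conj_conj] using
    hasSum_conj_mFourierCoeff_mul (f := fun k => conj (f k)) (by fun_prop) hg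

theorem norm_mFourier_apply (n : d → ℤ) (k : UnitAddTorus d) : ‖mFourier n k‖ = 1 := by
  simp only [mFourier, ContinuousMap.coe_mk, norm_prod, fourier_apply, Circle.norm_coe,
    Finset.prod_const_one]

theorem mFourier_apply_add (n : d → ℤ) (x y : UnitAddTorus d) :
    mFourier n (x + y) = mFourier n x * mFourier n y := by
  simp only [mFourier, ContinuousMap.coe_mk, ← Finset.prod_mul_distrib, Pi.add_apply,
    fourier_apply, smul_add, AddCircle.toCircle_add, Circle.coe_mul]

theorem mFourierCoeff_comp_add_left (f : UnitAddTorus d → ℂ) (v : UnitAddTorus d) (n : d → ℤ) :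
    mFourierCoeff (fun q => f (v + q)) n = mFourier n v * mFourierCoeff f n := by
  have hcancel : mFourier n v * mFourier (-n) v = 1 := by
    rw [← mFourier_add, add_neg_cancel, mFourier_zero, ContinuousMap.one_apply]
  rw [mFourierCoeff_eq_integral_volume, mFourierCoeff_eq_integral_volume,
    ← integral_add_left_eq_self (fun k => mFourier (-n) k * f k) v, ← integral_const_mul]
  refine integral_congr_ae (.of_forall fun q => ?_)
  simp only [mFourier_apply_add]
  linear_combination (-(mFourier (-n) q * f (v + q))) * hcancel

theorem integrable_of_continuous {E : Type*} [NormedAddCommGroup E] {f : UnitAddTorus d → E}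
    (hf : Continuous f) : Integrable f :=
  hf.integrable_of_hasCompactSupport (.of_compactSpace _)

theorem summable_norm_mFourierCoeff_neg_mul {f g : UnitAddTorus d → ℂ} (hf : Continuous f)
    (hg : Continuous g) : Summable fun n => ‖mFourierCoeff f (-n) * mFourierCoeff g n‖ := by
  refine .of_nonneg_of_le (fun n => norm_nonneg _) (fun n => ?_)
    (((hasSum_norm_sq_mFourierCoeff hf).summable.comp_injective neg_injective).add
      (hasSum_norm_sq_mFourierCoeff hg).summable)
  rw [norm_mul, Function.comp_apply]
  nlinarith [two_mul_le_add_sq ‖mFourierCoeff f (-n)‖ ‖mFourierCoeff g n‖,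
    norm_nonneg (mFourierCoeff f (-n)), norm_nonneg (mFourierCoeff g n)]

theorem hasSum_integral_integral_mul {f g h : UnitAddTorus d → ℂ} (hf : Continuous f)
    (hg : Continuous g) (hh : Continuous h) (w : UnitAddTorus d) :
    HasSum (fun n => mFourierCoeff f (-n) * (mFourierCoeff g (-n) * mFourierCoeff h n) *
      mFourier n w) (∫ p, f p * ∫ q, g q * h (p + q + w)) := by
  set c : (d → ℤ) → ℂ := fun n => mFourierCoeff g (-n) * mFourierCoeff h n
  have hinner (p : UnitAddTorus d) :
      HasSum (fun n => c n * mFourier n (p + w)) (∫ q, g q * h (p + q + w)) := by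
    have hparseval := hasSum_mFourierCoeff_neg_mul hg (g := fun q => h (p + w + q)) (by fun_prop)
    simp only [mFourierCoeff_comp_add_left] at hparseval
    convert! hparseval using 1
    · ext n
      ring
    · simp only [add_right_comm p w]
  set F : (d → ℤ) → UnitAddTorus d → ℂ := fun n p => f p * (c n * mFourier n (p + w)) with hF
  have hF_norm (n : d → ℤ) (p : UnitAddTorus d) : ‖F n p‖ = ‖c n‖ * ‖f p‖ := by
    rw [hF, norm_mul, norm_mul, norm_mFourier_apply, mul_one, mul_comm]
  have hF_summable : Summable fun n => ∫ p, ‖F n p‖ := by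
    simp only [hF_norm, integral_const_mul]
    exact (summable_norm_mFourierCoeff_neg_mul hg hh).mul_right _
  convert! hasSum_integral_of_summable_integral_norm
    (fun n => integrable_of_continuous (f := F n) (by fun_prop)) hF_summable using 1
  · ext n
    rw [mFourierCoeff_eq_integral_volume, neg_neg, ← integral_mul_const, ← integral_mul_const]
    refine integral_congr_ae (.of_forall fun p => ?_)
    simp only [hF, c, mFourier_apply_add]
    ring
  · exact integral_congr_ae (.of_forall fun p => by
      simp only [hF, tsum_mul_left, (hinner p).tsum_eq])

end TorusFourier

section FourierDecay

variable {d : Type*} [Fintype d] {D : ℝ} {f : UnitAddTorus d → ℂ}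

/-- `HasFourierDecay D f` says that the Fourier coefficients of `f` satisfy
`|f̂(n)| ≤ D (1 + |n|_∞) ^ (-1/2)`; the sup norm of `n` is expressed by a bound for each of its
coordinates. -/
def HasFourierDecay (D : ℝ) (f : UnitAddTorus d → ℂ) : Prop :=
  ∀ (n : d → ℤ) (j : d), ‖mFourierCoeff f n‖ ≤ D / √(1 + |(n j : ℝ)|)

theorem HasFourierDecay.neg_apply (hf : HasFourierDecay D f) (n : d → ℤ) (j : d) :
    ‖mFourierCoeff f (-n)‖ ≤ D / √(1 + |(n j : ℝ)|) := by
  simpa only [Pi.neg_apply, Int.cast_neg, abs_neg] using hf (-n) j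

theorem HasFourierDecay.norm_integral_le [Nonempty d] (hf : HasFourierDecay D f) :
    ‖∫ k, f k‖ ≤ D := by
  simpa [mFourierCoeff_eq_integral_volume, mFourier_zero] using hf 0 (Classical.arbitrary d)

theorem HasFourierDecay.ofReal_re (hf : HasFourierDecay D f) (hfc : Continuous f) :
    HasFourierDecay D fun k => ((f k).re : ℂ) := by
  intro n j
  have hcoeff : mFourierCoeff (fun k => ((f k).re : ℂ)) n =
      (mFourierCoeff f n + conj (mFourierCoeff f (-n))) / 2 := by
    rw [← mFourierCoeff_conj]
    simp only [mFourierCoeff_eq_integral_volume, Complex.re_eq_add_conj]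
    rw [← integral_add (integrable_of_continuous (by fun_prop))
      (integrable_of_continuous (by fun_prop)), ← integral_div]
    simp only [← mul_add, mul_div_assoc]
  calc _ ≤ (‖mFourierCoeff f n‖ + ‖mFourierCoeff f (-n)‖) / 2 := by
        rw [hcoeff, norm_div, Complex.norm_two, ← RCLike.norm_conj (mFourierCoeff f (-n))]
        gcongr
        exact norm_add_le _ _
    _ ≤ D / √(1 + |(n j : ℝ)|) := by linarith [hf n j, hf.neg_apply n j]

theorem HasFourierDecay.sum {ι : Type*} {s : Finset ι} {g : ι → UnitAddTorus d → ℂ}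
    (hg : ∀ i ∈ s, HasFourierDecay D (g i)) (hgc : ∀ i ∈ s, Continuous (g i)) :
    HasFourierDecay (s.card * D) fun k => ∑ i ∈ s, g i k := by
  intro n j
  have hcoeff : mFourierCoeff (fun k => ∑ i ∈ s, g i k) n = ∑ i ∈ s, mFourierCoeff (g i) n := by
    simp only [mFourierCoeff_eq_integral_volume, Finset.mul_sum]
    refine integral_finsetSum _ fun i hi => integrable_of_continuous ?_
    have := hgc i hi
    fun_prop
  rw [hcoeff, mul_div_assoc, ← nsmul_eq_mul]
  exact (norm_sum_le _ _).trans (Finset.sum_le_card_nsmul _ _ _ fun i hi => hg i hi n j)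

end FourierDecay

section Resolvent

@[fun_prop]
theorem continuous_kineticEnergy : Continuous kineticEnergy := by
  unfold kineticEnergy
  fun_prop

theorem kineticEnergy_neg (k : Torus3) : kineticEnergy (-k) = kineticEnergy k := by
  simp only [kineticEnergy, Pi.neg_apply, cosTwoPi_neg]

theorem kineticEnergy_mem_Icc (k : Torus3) : kineticEnergy k ∈ Set.Icc (0 : ℝ) 6 := by
  rw [kineticEnergy, Fin.sum_univ_three]
  constructor <;> linarith [cosTwoPi_le_one (k 0), cosTwoPi_le_one (k 1), cosTwoPi_le_one (k 2),
    neg_one_le_cosTwoPi (k 0), neg_one_le_cosTwoPi (k 1), neg_one_le_cosTwoPi (k 2)]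

theorem norm_mFourierCoeff_exp_kineticEnergy (a t : ℝ) (n : Fin 3 → ℤ) :
    ‖mFourierCoeff (fun k => Complex.exp ((-(t * (kineticEnergy k - a)) : ℝ) * Complex.I)) n‖ =
      ∏ i, ‖besselCoeff (n i) t‖ := by
  have hcoeff : mFourierCoeff
      (fun k => Complex.exp ((-(t * (kineticEnergy k - a)) : ℝ) * Complex.I)) n =
        Complex.exp ((t * (a - 3) : ℝ) * Complex.I) * ∏ i, besselCoeff (n i) t := by
    simp only [mFourierCoeff, besselCoeff, fourierCoeff]
    rw [← integral_fintype_prod_eq_prod, ← integral_const_mul]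
    refine integral_congr_ae (.of_forall fun k => ?_)
    simp only [mFourier, ContinuousMap.coe_mk, kineticEnergy, smul_eq_mul,
      Finset.prod_mul_distrib, Pi.neg_apply, ← Complex.exp_sum]
    rw [mul_left_comm, ← Complex.exp_add]
    congr 2
    simp only [Fin.sum_univ_three]
    push_cast
    ring
  rw [hcoeff, norm_mul, Complex.norm_exp_ofReal_mul_I, one_mul, norm_prod]

theorem inv_eq_setIntegral_exp {z : ℂ} (hz : 0 < z.re) :
    z⁻¹ = ∫ t in Set.Ioi (0 : ℝ), Complex.exp (-z * t) := by
  rw [integral_exp_mul_complex_Ioi (by simpa using hz)]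
  simp [neg_div_neg_eq]

theorem mFourierCoeff_resolvent {d : Type*} [Fintype d] {e : UnitAddTorus d → ℝ}
    (he : Continuous e) {δ : ℝ} (hδ : 0 < δ) (n : d → ℤ) :
    mFourierCoeff (fun k => (δ + e k * Complex.I : ℂ)⁻¹) n = ∫ t in Set.Ioi (0 : ℝ),
      (Real.exp (-δ * t) : ℂ) *
        mFourierCoeff (fun k => Complex.exp ((-(t * e k) : ℝ) * Complex.I)) n := by
  set F : UnitAddTorus d → ℝ → ℂ := fun k t =>
    (Real.exp (-δ * t) : ℂ) * (mFourier (-n) k * Complex.exp ((-(t * e k) : ℝ) * Complex.I)) with hF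
  have hF_norm (k : UnitAddTorus d) (t : ℝ) : ‖F k t‖ = Real.exp (-δ * t) := by
    rw [hF, norm_mul, norm_mul, norm_mFourier_apply, Complex.norm_exp_ofReal_mul_I,
      Complex.norm_real, Real.norm_of_nonneg (Real.exp_nonneg _), mul_one, mul_one]
  have hF_integrable : Integrable (Function.uncurry F)
      (volume.prod (volume.restrict (Set.Ioi (0 : ℝ)))) := by
    refine ((integrableOn_exp_mul_Ioi (neg_lt_zero.2 hδ) 0).comp_snd
      (volume : Measure (UnitAddTorus d))).mono' ?_ (.of_forall fun x => (hF_norm x.1 x.2).le)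
    refine Continuous.aestronglyMeasurable ?_
    simp only [Function.uncurry_def, hF]
    fun_prop
  calc _ = ∫ k, ∫ t in Set.Ioi (0 : ℝ), F k t := by
        rw [mFourierCoeff_eq_integral_volume]
        refine integral_congr_ae (.of_forall fun k => ?_)
        beta_reduce
        rw [inv_eq_setIntegral_exp (by simpa using hδ), ← integral_const_mul]
        refine integral_congr_ae (.of_forall fun t => ?_)
        simp only [hF]
        rw [mul_left_comm, Complex.ofReal_exp, ← Complex.exp_add]
        push_cast
        ring_nf
    _ = ∫ t in Set.Ioi (0 : ℝ), ∫ k, F k t := integral_integral_swap hF_integrable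
    _ = _ := by
        simp only [hF, integral_const_mul, mFourierCoeff_eq_integral_volume]

theorem hasFourierDecay_resolvent {δ : ℝ} (hδ : 0 < δ) (a : ℝ) :
    HasFourierDecay (10 ^ 4)
      fun k : Torus3 => (δ + (kineticEnergy k - a : ℝ) * Complex.I : ℂ)⁻¹ := by
  intro n j
  rw [← ENNReal.ofReal_le_ofReal_iff (by positivity), ofReal_norm,
    mFourierCoeff_resolvent (by fun_prop) hδ]
  refine (enorm_integral_le_lintegral_enorm _).trans
    (le_trans ?_ (setLIntegral_prod_besselCoeff_le n j))
  refine setLIntegral_mono' measurableSet_Ioi fun t (ht : 0 < t) => ?_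
  rw [← ofReal_norm, norm_mul, norm_mFourierCoeff_exp_kineticEnergy, Complex.norm_real,
    Real.norm_of_nonneg (Real.exp_nonneg _)]
  refine ENNReal.ofReal_le_ofReal (mul_le_of_le_one_left (by positivity) ?_)
  rw [Real.exp_le_one_iff, neg_mul, neg_nonpos]
  positivity

theorem hasFourierDecay_lorentzian {δ : ℝ} (hδ : 0 < δ) (a : ℝ) :
    HasFourierDecay (10 ^ 4) fun k : Torus3 => (lorentzian δ (kineticEnergy k - a) : ℂ) := by
  have hcont : Continuous
      fun k : Torus3 => (δ + (kineticEnergy k - a : ℝ) * Complex.I : ℂ)⁻¹ := by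
    refine Continuous.inv₀ (by fun_prop) fun k hk => hδ.ne' ?_
    simpa using congrArg Complex.re hk
  convert! (hasFourierDecay_resolvent hδ a).ofReal_re hcont using 3 with k
  simp [lorentzian, Complex.inv_re, Complex.normSq_apply, sq]

end Resolvent

section FrequencySplitting

theorem norm_le_sum_norm_add_of_hasSum {ι E : Type*} [SeminormedAddCommGroup E] {u : ι → E} {T : E}
    (hu : HasSum u T) {v : ι → ℝ} {V : ℝ} (hv : HasSum v V) {s : Finset ι}
    (hv₀ : ∀ n ∈ s, 0 ≤ v n) (huv : ∀ n ∉ s, ‖u n‖ ≤ v n) :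
    ‖T‖ ≤ ∑ n ∈ s, ‖u n‖ + V := by
  classical
  have hs : HasSum (fun n => if n ∈ s then ‖u n‖ else 0) (∑ n ∈ s, ‖u n‖) := by
    rw [← Finset.sum_congr rfl fun n hn => if_pos (t := ‖u n‖) (e := 0) hn]
    exact hasSum_sum_of_ne_finset_zero fun n hn => if_neg hn
  refine hu.norm_le_of_bounded (hs.add hv) fun n => ?_
  by_cases hn : n ∈ s
  · simpa only [if_pos hn] using le_add_of_nonneg_right (hv₀ n hn)
  · simpa only [if_neg hn, zero_add] using huv n hn

theorem sum_Icc_one_div_sqrt_le (N : ℕ) :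
    ∑ m ∈ Finset.Icc (-(N : ℤ)) N, 1 / √(1 + |(m : ℝ)|) ≤ 4 * √(N + 1) := by
  induction N with
  | zero => simp
  | succ N ih =>
    have hIcc : Finset.Icc (-((N + 1 : ℕ) : ℤ)) ((N + 1 : ℕ) : ℤ) =
        insert (-((N + 1 : ℕ) : ℤ)) (insert ((N + 1 : ℕ) : ℤ) (Finset.Icc (-(N : ℤ)) N)) := by
      ext m
      simp only [Finset.mem_Icc, Finset.mem_insert]
      omega
    rw [hIcc, Finset.sum_insert (by simp; omega), Finset.sum_insert (by simp)]
    simp only [Int.cast_neg, Int.cast_natCast, abs_neg, Nat.abs_cast]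
    rw [add_comm (1 : ℝ)]
    set v := √((N + 1 : ℕ) + 1 : ℝ) with hv
    have hv₀ : 0 < v := by positivity
    have hv_sq : v ^ 2 = N + 1 + 1 := by
      rw [hv, Real.sq_sqrt (by positivity)]
      push_cast
      ring
    have hu_sq : √(N + 1 : ℝ) ^ 2 = N + 1 := Real.sq_sqrt (by positivity)
    have hstep : 1 / v ≤ 2 * (v - √(N + 1)) := by
      rw [div_le_iff₀ hv₀]
      nlinarith [sq_nonneg (v - √(N + 1))]
    linarith

/-- The cube `[-N, N]^d` of lattice frequencies, up to which the decay of Fourier coefficients is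
used and beyond which their square summability is. -/
noncomputable def frequencyBox (d : Type*) [Fintype d] [DecidableEq d] (N : ℕ) : Finset (d → ℤ) :=
  Fintype.piFinset fun _ => Finset.Icc (-(N : ℤ)) N

variable {d : Type*} [Fintype d] [DecidableEq d]

theorem exists_lt_abs_of_notMem_frequencyBox {N : ℕ} {n : d → ℤ} (hn : n ∉ frequencyBox d N) :
    ∃ j, (N : ℤ) < |n j| := by
  simpa only [frequencyBox, Fintype.mem_piFinset, Finset.mem_Icc, ← abs_le, not_forall,
    not_le] using hn

theorem sum_frequencyBox_prod_le (N : ℕ) :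
    ∑ n ∈ frequencyBox d N, ∏ j, 1 / √(1 + |(n j : ℝ)|) ≤ (4 * √(N + 1)) ^ Fintype.card d := by
  rw [frequencyBox, ← Finset.prod_univ_sum (fun _ : d => Finset.Icc (-(N : ℤ)) N)
    fun _ m => 1 / √(1 + |(m : ℝ)|), Finset.prod_const, Finset.card_univ]
  gcongr
  exact sum_Icc_one_div_sqrt_le N

end FrequencySplitting

section CrossingEstimate

variable {D : ℝ} {f g h : Torus3 → ℂ}

theorem sum_frequencyBox_norm_mul_le (hf : HasFourierDecay D f) (hg : HasFourierDecay D g)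
    (hh : HasFourierDecay D h) (hD : 0 ≤ D) (N : ℕ) :
    ∑ n ∈ frequencyBox (Fin 3) N,
        ‖mFourierCoeff f (-n)‖ * (‖mFourierCoeff g (-n)‖ * ‖mFourierCoeff h n‖) ≤
      D ^ 3 * (4 * √(N + 1)) ^ 3 := by
  calc _ ≤ ∑ n ∈ frequencyBox (Fin 3) N, D ^ 3 * ∏ j, 1 / √(1 + |(n j : ℝ)|) := by
        refine Finset.sum_le_sum fun n _ => ?_
        calc _ ≤ D / √(1 + |(n 0 : ℝ)|) * (D / √(1 + |(n 1 : ℝ)|) * (D / √(1 + |(n 2 : ℝ)|))) := by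
              gcongr
              exacts [hf.neg_apply n 0, hg.neg_apply n 1, hh n 2]
          _ = D ^ 3 * ∏ j, 1 / √(1 + |(n j : ℝ)|) := by
              rw [Fin.prod_univ_three]
              ring
    _ ≤ D ^ 3 * (4 * √(N + 1)) ^ 3 := by
        rw [← Finset.mul_sum]
        gcongr
        exact sum_frequencyBox_prod_le N

theorem norm_integral_integral_mul_le_of_box (hfc : Continuous f) (hgc : Continuous g)
    (hhc : Continuous h) (hf : HasFourierDecay D f) (hg : HasFourierDecay D g)
    (hh : HasFourierDecay D h) (hD : 0 ≤ D) {S : ℝ} (hgS : ∫ k, ‖g k‖ ^ 2 ≤ S)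
    (hhS : ∫ k, ‖h k‖ ^ 2 ≤ S) (w : Torus3) (N : ℕ) :
    ‖∫ p, f p * ∫ q, g q * h (p + q + w)‖ ≤
      D ^ 3 * (4 * √(N + 1)) ^ 3 + D / √(N + 1) * S := by
  set c := D / √(N + 1 : ℝ)
  have hc₀ : 0 ≤ c := by positivity
  have hsq := ((((Equiv.neg _).hasSum_iff.2 (hasSum_norm_sq_mFourierCoeff hgc)).add
    (hasSum_norm_sq_mFourierCoeff hhc)).mul_left (c / 2))
  have hnorm (n : Fin 3 → ℤ) :
      ‖mFourierCoeff f (-n) * (mFourierCoeff g (-n) * mFourierCoeff h n) * mFourier n w‖ =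
        ‖mFourierCoeff f (-n)‖ * (‖mFourierCoeff g (-n)‖ * ‖mFourierCoeff h n‖) := by
    rw [norm_mul, norm_mFourier_apply, mul_one, norm_mul, norm_mul]
  refine (norm_le_sum_norm_add_of_hasSum (hasSum_integral_integral_mul hfc hgc hhc w) hsq
    (s := frequencyBox (Fin 3) N) (fun n _ => ?_) fun n hn => ?_).trans ?_
  · simp only [Function.comp_apply]
    positivity
  · have hfn : ‖mFourierCoeff f (-n)‖ ≤ c := by
      obtain ⟨j, hj⟩ := exists_lt_abs_of_notMem_frequencyBox hn
      have hj' : (N : ℝ) ≤ |(n j : ℝ)| := by exact_mod_cast hj.le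
      exact (hf.neg_apply n j).trans (div_le_div_of_nonneg_left hD (by positivity)
        (Real.sqrt_le_sqrt (by linarith)))
    rw [hnorm]
    calc _ ≤ c * (‖mFourierCoeff g (-n)‖ * ‖mFourierCoeff h n‖) := by gcongr
      _ ≤ c / 2 * (‖mFourierCoeff g (-n)‖ ^ 2 + ‖mFourierCoeff h n‖ ^ 2) := by
          nlinarith [mul_le_mul_of_nonneg_left
            (two_mul_le_add_sq ‖mFourierCoeff g (-n)‖ ‖mFourierCoeff h n‖) hc₀]
  · simp only [hnorm]
    refine add_le_add (sum_frequencyBox_norm_mul_le hf hg hh hD N) ?_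
    nlinarith [mul_le_mul_of_nonneg_left (add_le_add hgS hhS) hc₀]

theorem norm_integral_integral_mul_le (hfc : Continuous f) (hgc : Continuous g)
    (hhc : Continuous h) (hf : HasFourierDecay D f) (hg : HasFourierDecay D g)
    (hh : HasFourierDecay D h) (hD : 1 ≤ D) {B : ℝ} (hB : 1 ≤ B) (hgB : ∫ k, ‖g k‖ ^ 2 ≤ B * D)
    (hhB : ∫ k, ‖h k‖ ^ 2 ≤ B * D) (w : Torus3) :
    ‖∫ p, f p * ∫ q, g q * h (p + q + w)‖ ≤ 220 * D ^ 3 * B ^ (3 / 4 : ℝ) := by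
  have hB₀ : 0 ≤ B := by linarith
  set X := B ^ (1 / 4 : ℝ) with hX
  have hX₁ : 1 ≤ X := Real.one_le_rpow hB (by norm_num)
  have hX_three : B ^ (3 / 4 : ℝ) = X ^ 3 := by
    rw [hX, ← Real.rpow_mul_natCast hB₀]
    norm_num
  have hX_four : B = X ^ 4 := by
    rw [hX, ← Real.rpow_mul_natCast hB₀]
    norm_num
  set N := ⌊X ^ 2⌋₊
  have hN_ge : X ≤ √(N + 1) := Real.le_sqrt_of_sq_le (Nat.lt_floor_add_one _).le
  have hN_le : √(N + 1) ≤ 3 / 2 * X := by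
    have := Nat.floor_le (sq_nonneg X)
    exact Real.sqrt_le_iff.2 ⟨by positivity, by nlinarith⟩
  calc _ ≤ D ^ 3 * (4 * √(N + 1)) ^ 3 + D / √(N + 1) * (B * D) :=
        norm_integral_integral_mul_le_of_box hfc hgc hhc hf hg hh (by linarith) hgB hhB w N
    _ ≤ D ^ 3 * (4 * (3 / 2 * X)) ^ 3 + D / X * (B * D) := by gcongr
    _ = 216 * (D ^ 3 * X ^ 3) + D ^ 2 * X ^ 3 := by
        rw [hX_four]
        field_simp
        ring
    _ ≤ 216 * (D ^ 3 * X ^ 3) + D ^ 3 * X ^ 3 := by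
        gcongr
        norm_num
    _ ≤ 220 * D ^ 3 * B ^ (3 / 4 : ℝ) := by
        rw [hX_three]
        have : 0 ≤ D ^ 3 * X ^ 3 := by positivity
        linarith

end CrossingEstimate

section DyadicMajorant

variable {ε : ℝ} (J : ℕ) (a : ℝ)

/-- A superposition of Lorentzians of the dyadic widths `2 ^ l * ε`, `l < J`, in the variable
`e_Δ(k) - a`; it dominates `((e_Δ(k) - a) ^ 2 + ε ^ 2) ^ (-1/2)` up to a constant. -/
noncomputable def dyadicMajorant (ε : ℝ) (J : ℕ) (a : ℝ) (k : Torus3) : ℝ :=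
  ∑ l ∈ Finset.range J, lorentzian (2 ^ l * ε) (kineticEnergy k - a)

theorem dyadicMajorant_nonneg (hε : 0 ≤ ε) (k : Torus3) : 0 ≤ dyadicMajorant ε J a k :=
  Finset.sum_nonneg fun _ _ => lorentzian_nonneg (by positivity) _

theorem dyadicMajorant_neg (ε : ℝ) (k : Torus3) :
    dyadicMajorant ε J a (-k) = dyadicMajorant ε J a k := by
  simp only [dyadicMajorant, kineticEnergy_neg]

theorem continuous_dyadicMajorant (hε : 0 < ε) : Continuous (dyadicMajorant ε J a) :=
  continuous_finsetSum _ fun l _ =>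
    (continuous_lorentzian (by positivity)).comp (by fun_prop)

theorem dyadicMajorant_le_two_div (hε : 0 < ε) (k : Torus3) : dyadicMajorant ε J a k ≤ 2 / ε :=
  calc dyadicMajorant ε J a k ≤ ∑ l ∈ Finset.range J, (2 ^ l * ε)⁻¹ :=
        Finset.sum_le_sum fun l _ => lorentzian_le_inv (by positivity) _
    _ = (∑ l ∈ Finset.range J, (1 / 2 : ℝ) ^ l) / ε := by
        rw [Finset.sum_div]
        refine Finset.sum_congr rfl fun l _ => ?_
        rw [one_div, inv_pow, mul_inv, div_eq_mul_inv]
    _ ≤ 2 / ε := by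
        gcongr
        exact sum_geometric_two_le J

theorem hasFourierDecay_dyadicMajorant (hε : 0 < ε) :
    HasFourierDecay (J * 10 ^ 4) fun k => (dyadicMajorant ε J a k : ℂ) := by
  have hdecay := HasFourierDecay.sum (s := Finset.range J)
    (fun l _ => hasFourierDecay_lorentzian (δ := 2 ^ l * ε) (by positivity) a) fun l _ => by
      have := continuous_lorentzian (δ := 2 ^ l * ε) (by positivity)
      fun_prop
  simpa only [Finset.card_range, dyadicMajorant, Complex.ofReal_sum] using hdecay

theorem inv_le_four_mul_lorentzian {δ x y : ℝ} (hδ : 0 < δ) (hxy : |x| ≤ y) (hδy : δ ≤ y)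
    (hyδ : y ≤ 2 * δ) : y⁻¹ ≤ 4 * lorentzian δ x := by
  have hx_sq : x ^ 2 ≤ y ^ 2 := sq_le_sq' (abs_le.1 hxy).1 (abs_le.1 hxy).2
  rw [lorentzian, ← mul_div_assoc, inv_eq_one_div, div_le_div_iff₀ (by linarith) (by positivity)]
  nlinarith

theorem inv_le_four_mul_dyadicMajorant {J : ℕ} {y : ℝ} {k : Torus3} (hε : 0 < ε) (hεy : ε ≤ y)
    (hyJ : y < 2 ^ J * ε) (hky : |kineticEnergy k - a| ≤ y) :
    y⁻¹ ≤ 4 * dyadicMajorant ε J a k := by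
  obtain ⟨l, hl_le, hl_lt⟩ := exists_nat_pow_near ((one_le_div hε).2 hεy) (one_lt_two (α := ℝ))
  rw [le_div_iff₀ hε] at hl_le
  rw [div_lt_iff₀ hε, pow_succ] at hl_lt
  have hlJ : l < J := by
    have hpow : (2 : ℝ) ^ l < 2 ^ J := lt_of_mul_lt_mul_right (hl_le.trans_lt hyJ) hε.le
    exact (pow_lt_pow_iff_right₀ one_lt_two).1 hpow
  refine (inv_le_four_mul_lorentzian (by positivity) hky hl_le (by linarith)).trans ?_
  gcongr
  exact Finset.single_le_sum (f := fun l => lorentzian (2 ^ l * ε) (kineticEnergy k - a))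
    (fun i _ => lorentzian_nonneg (by positivity) _) (Finset.mem_range.2 hlJ)

theorem integral_sq_le_of_hasFourierDecay {d : Type*} [Fintype d] [Nonempty d] {D B : ℝ}
    {f : UnitAddTorus d → ℝ} (hfc : Continuous f) (hf : HasFourierDecay D fun k => (f k : ℂ))
    (hf₀ : ∀ k, 0 ≤ f k) (hfB : ∀ k, f k ≤ B) : ∫ k, f k ^ 2 ≤ B * D := by
  have h_int : ∫ k, f k ≤ D := by
    have h := hf.norm_integral_le
    rw [integral_complex_ofReal, Complex.norm_real] at h
    exact (Real.le_norm_self _).trans h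
  calc ∫ k, f k ^ 2 ≤ ∫ k, B * f k :=
        integral_mono (integrable_of_continuous (by fun_prop))
          (integrable_of_continuous (by fun_prop)) fun k => by
            simpa only [sq] using mul_le_mul_of_nonneg_right (hfB k) (hf₀ k)
    _ ≤ B * D := by
        rw [integral_const_mul]
        exact mul_le_mul_of_nonneg_left h_int ((hf₀ 0).trans (hfB 0))

theorem integral_units_zsmul {G E : Type*} [AddCommGroup G] [MeasurableSpace G] [MeasurableNeg G]
    [NormedAddCommGroup E] [NormedSpace ℝ E] (μ : Measure G) [μ.IsNegInvariant] (κ : ℤˣ)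
    (f : G → E) : ∫ q, f ((κ : ℤ) • q) ∂μ = ∫ q, f q ∂μ := by
  rcases Int.units_eq_one_or κ with rfl | rfl
  · simp
  · simpa using integral_neg_eq_self f μ

theorem dyadicMajorant_units_zsmul (κ : ℤˣ) (ε : ℝ) (k : Torus3) :
    dyadicMajorant ε J a ((κ : ℤ) • k) = dyadicMajorant ε J a k := by
  rcases Int.units_eq_one_or κ with rfl | rfl
  · simp
  · simp [dyadicMajorant_neg]

theorem integral_integral_dyadicMajorant_le {J : ℕ} (hε : 0 < ε) (hε₂ : ε ≤ 2) (hJ : 1 ≤ J)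
    (a : Fin 3 → ℝ) (κ : ℤˣ) (w : Torus3) :
    ∫ p, dyadicMajorant ε J (a 0) p * ∫ q, dyadicMajorant ε J (a 1) q *
        dyadicMajorant ε J (a 2) (p + (κ : ℤ) • q + w) ≤
      440 * (J * 10 ^ 4) ^ 3 * ε ^ (-(3 / 4) : ℝ) := by
  have hD : (1 : ℝ) ≤ J * 10 ^ 4 := by
    have : (1 : ℝ) ≤ J := by exact_mod_cast hJ
    linarith
  have hcont (i : Fin 3) : Continuous fun k => (dyadicMajorant ε J (a i) k : ℂ) :=
    Complex.continuous_ofReal.comp (continuous_dyadicMajorant J (a i) hε)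
  have hdecay (i : Fin 3) := hasFourierDecay_dyadicMajorant J (a i) hε
  have hsq (i : Fin 3) : ∫ k, ‖(dyadicMajorant ε J (a i) k : ℂ)‖ ^ 2 ≤ 2 / ε * (J * 10 ^ 4) := by
    simpa only [Complex.norm_real, Real.norm_eq_abs, sq_abs] using
      integral_sq_le_of_hasFourierDecay (continuous_dyadicMajorant J (a i) hε) (hdecay i)
        (dyadicMajorant_nonneg J (a i) hε.le) (dyadicMajorant_le_two_div J (a i) hε)
  have hreflect (p : Torus3) :
      ∫ q, dyadicMajorant ε J (a 1) q * dyadicMajorant ε J (a 2) (p + (κ : ℤ) • q + w) =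
        ∫ q, dyadicMajorant ε J (a 1) q * dyadicMajorant ε J (a 2) (p + q + w) := by
    have : (volume : Measure Torus3).IsNegInvariant :=
      Measure.IsAddHaarMeasure.isNegInvariant_of_regular _
    simpa only [dyadicMajorant_units_zsmul] using integral_units_zsmul volume κ fun q =>
      dyadicMajorant ε J (a 1) q * dyadicMajorant ε J (a 2) (p + q + w)
  have hnorm := norm_integral_integral_mul_le (hcont 0) (hcont 1) (hcont 2) (hdecay 0) (hdecay 1)
    (hdecay 2) hD ((one_le_div hε).2 hε₂) (hsq 1) (hsq 2) w
  simp only [← Complex.ofReal_mul, integral_complex_ofReal, Complex.norm_real] at hnorm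
  simp only [hreflect]
  calc _ ≤ 220 * (J * 10 ^ 4) ^ 3 * (2 / ε) ^ (3 / 4 : ℝ) := (Real.le_norm_self _).trans hnorm
    _ ≤ 220 * (J * 10 ^ 4) ^ 3 * (2 * ε ^ (-(3 / 4) : ℝ)) := by
        rw [Real.div_rpow zero_le_two hε.le, div_eq_mul_inv, ← Real.rpow_neg hε.le]
        gcongr
        exact Real.rpow_le_self_of_one_le one_le_two (by norm_num)
    _ = 440 * (J * 10 ^ 4) ^ 3 * ε ^ (-(3 / 4) : ℝ) := by ring

end DyadicMajorant

section ResolventComparison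

theorem re_mem_Icc_and_cases {z : ℂ} (hz : z ∈ contour ∪ conjContour) :
    z.re ∈ Set.Icc (-1 : ℝ) 7 ∧ (z.im = 0 ∨ |z.im| = 1 ∨ z.re = -1 ∨ z.re = 7) := by
  have hcontour {z : ℂ} (hz : z ∈ contour) :
      z.re ∈ Set.Icc (-1 : ℝ) 7 ∧ (z.im = 0 ∨ |z.im| = 1 ∨ z.re = -1 ∨ z.re = 7) := by
    simp only [contour, Set.mem_union, Complex.mem_reProdIm, Set.mem_singleton_iff] at hz
    rcases hz with ⟨hre, him⟩ | (⟨hre, him⟩ | ⟨hre, -⟩) | ⟨hre, -⟩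
    · exact ⟨hre, by simp [him]⟩
    · exact ⟨hre, by simp [him]⟩
    · exact ⟨by norm_num [hre], by simp [hre]⟩
    · exact ⟨by norm_num [hre], by simp [hre]⟩
  rcases hz with hz | ⟨z, hz, rfl⟩
  · exact hcontour hz
  · simpa using hcontour hz

theorem sqrt_le_mul_norm_of_half_le {x ε : ℝ} {v : ℂ} (hx : |x| ≤ 7) (hε : |ε| ≤ 1)
    (hv : 1 / 2 ≤ ‖v‖) : √(x ^ 2 + ε ^ 2) ≤ 16 * ‖v‖ := by
  have hx_sq := sq_le_sq' (abs_le.1 hx).1 (abs_le.1 hx).2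
  have hε_sq := sq_le_sq' (abs_le.1 hε).1 (abs_le.1 hε).2
  have hsqrt : √(x ^ 2 + ε ^ 2) ≤ 8 := Real.sqrt_le_iff.2 ⟨by norm_num, by linarith⟩
  linarith

theorem sqrt_le_mul_norm_resolvent {ε : ℝ} (hε : 0 ≤ ε) (hε₂ : ε ≤ 1 / 2) (s : ℤˣ) {z : ℂ}
    (hz : z ∈ contour ∪ conjContour) (k : Torus3) :
    √((kineticEnergy k - z.re) ^ 2 + ε ^ 2) ≤
      16 * ‖(kineticEnergy k : ℂ) - z + ((s : ℤ) : ℂ) * Complex.I * (ε : ℂ)‖ := by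
  obtain ⟨hre, hcases⟩ := re_mem_Icc_and_cases hz
  have he := kineticEnergy_mem_Icc k
  set v : ℂ := (kineticEnergy k : ℂ) - z + ((s : ℤ) : ℂ) * Complex.I * (ε : ℂ) with hv
  have hv_re : v.re = kineticEnergy k - z.re := by simp [hv]
  have hv_im : v.im = (s : ℤ) * ε - z.im := by
    simp only [hv, Complex.add_im, Complex.sub_im, Complex.ofReal_im, Complex.mul_im,
      Complex.mul_re, Complex.intCast_re, Complex.intCast_im, Complex.I_re, Complex.I_im,
      Complex.ofReal_re]
    ring
  have hs_abs : |((s : ℤ) : ℝ) * ε| = ε := by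
    rw [abs_mul, ← Int.cast_abs, Int.isUnit_iff_abs_eq.1 s.isUnit, Int.cast_one, one_mul,
      abs_of_nonneg hε]
  have hx : |kineticEnergy k - z.re| ≤ 7 :=
    abs_le.2 ⟨by linarith [he.1, hre.2], by linarith [he.2, hre.1]⟩
  have hε_abs : |ε| ≤ 1 := abs_le.2 ⟨by linarith, by linarith⟩
  rcases hcases with him | him | hre' | hre'
  · rw [Complex.norm_eq_sqrt_sq_add_sq, hv_re, hv_im, him, sub_zero, ← sq_abs (_ * ε), hs_abs]
    linarith [Real.sqrt_nonneg ((kineticEnergy k - z.re) ^ 2 + ε ^ 2)]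
  · refine sqrt_le_mul_norm_of_half_le hx hε_abs (le_trans ?_ (Complex.abs_im_le_norm v))
    have htriangle := abs_sub_abs_le_abs_sub z.im ((s : ℤ) * ε)
    rw [abs_sub_comm, him, hs_abs, ← hv_im] at htriangle
    linarith
  · refine sqrt_le_mul_norm_of_half_le hx hε_abs (le_trans ?_ (Complex.abs_re_le_norm v))
    rw [hv_re, hre']
    exact le_abs.2 (.inl (by linarith [he.1]))
  · refine sqrt_le_mul_norm_of_half_le hx hε_abs (le_trans ?_ (Complex.abs_re_le_norm v))
    rw [hv_re, hre']
    exact le_abs.2 (.inr (by linarith [he.2]))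

theorem resolventModulus_le {ε : ℝ} (hε : 0 < ε) (hε₂ : ε ≤ 1 / 2) {J : ℕ} (hJ : 8 < 2 ^ J * ε)
    (s : ℤˣ) {z : ℂ} (hz : z ∈ contour ∪ conjContour) (k : Torus3) :
    resolventModulus ε s z k ≤ ENNReal.ofReal (64 * dyadicMajorant ε J z.re k) := by
  have hre := (re_mem_Icc_and_cases hz).1
  have he := kineticEnergy_mem_Icc k
  have hnorm := sqrt_le_mul_norm_resolvent hε.le hε₂ s hz k
  set y := √((kineticEnergy k - z.re) ^ 2 + ε ^ 2)
  have hy : 0 < y := Real.sqrt_pos.2 (by positivity)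
  have hy_le : y ≤ 8 :=
    Real.sqrt_le_iff.2 ⟨by norm_num, by nlinarith [he.1, he.2, hre.1, hre.2]⟩
  have hmajorant := inv_le_four_mul_dyadicMajorant z.re hε
    (Real.le_sqrt_of_sq_le (le_add_of_nonneg_left (sq_nonneg _))) (hy_le.trans_lt hJ)
    (Real.abs_le_sqrt (le_add_of_nonneg_right (sq_nonneg _)))
  rw [resolventModulus]
  set v := (kineticEnergy k : ℂ) - z + ((s : ℤ) : ℂ) * Complex.I * (ε : ℂ)
  have hv : 0 < ‖v‖ := by linarith
  rw [← ofReal_norm, ← ENNReal.ofReal_inv_of_pos hv]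
  refine ENNReal.ofReal_le_ofReal ?_
  calc ‖v‖⁻¹ ≤ (y / 16)⁻¹ := inv_anti₀ (by positivity) (by linarith)
    _ = 16 * y⁻¹ := by rw [inv_div, div_eq_mul_inv]
    _ ≤ 64 * dyadicMajorant ε J z.re k := by linarith

theorem lintegral_resolventModulus_mul_le {ε : ℝ} (hε : 0 < ε) (hε₂ : ε ≤ 1 / 2) {J : ℕ}
    (hJ : 1 ≤ J) (hJε : 8 < 2 ^ J * ε) (s : Fin 3 → ℤˣ) (κ : ℤˣ) {z : Fin 3 → ℂ}
    (hz : ∀ i, z i ∈ contour ∪ conjContour) (w : Torus3) :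
    ∫⁻ x : Torus3 × Torus3, resolventModulus ε (s 0) (z 0) x.1 *
        resolventModulus ε (s 1) (z 1) x.2 *
        resolventModulus ε (s 2) (z 2) (x.1 + (κ : ℤ) • x.2 + w) ≤
      ENNReal.ofReal (64 ^ 3 * (440 * (J * 10 ^ 4) ^ 3 * ε ^ (-(3 / 4) : ℝ))) := by
  set m : Fin 3 → Torus3 → ℝ := fun i => dyadicMajorant ε J (z i).re
  have hm_nonneg (i k) : 0 ≤ m i k := dyadicMajorant_nonneg J _ hε.le k
  have hm_cont (i) : Continuous (m i) := continuous_dyadicMajorant J _ hε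
  set F : Torus3 × Torus3 → ℝ := fun x =>
    64 ^ 3 * (m 0 x.1 * (m 1 x.2 * m 2 (x.1 + (κ : ℤ) • x.2 + w))) with hF
  have hF_int : Integrable F := by
    have hF_cont : Continuous F := by fun_prop
    exact hF_cont.integrable_of_hasCompactSupport (.of_compactSpace _)
  have hF_nonneg (x) : 0 ≤ F x := mul_nonneg (by norm_num)
    (mul_nonneg (hm_nonneg 0 _) (mul_nonneg (hm_nonneg 1 _) (hm_nonneg 2 _)))
  have hmodulus (i k) : resolventModulus ε (s i) (z i) k ≤ ENNReal.ofReal (64 * m i k) :=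
    resolventModulus_le hε hε₂ hJε (s i) (hz i) k
  calc _ ≤ ∫⁻ x, ENNReal.ofReal (F x) := by
        refine lintegral_mono fun x => (mul_le_mul' (mul_le_mul' (hmodulus 0 _) (hmodulus 1 _))
          (hmodulus 2 _)).trans_eq ?_
        have := hm_nonneg 0 x.1
        have := hm_nonneg 1 x.2
        rw [← ENNReal.ofReal_mul (by positivity), ← ENNReal.ofReal_mul (by positivity)]
        congr 1
        ring
    _ = ENNReal.ofReal (∫ x, F x) :=
        (ofReal_integral_eq_lintegral_ofReal hF_int (.of_forall hF_nonneg)).symm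
    _ = ENNReal.ofReal (64 ^ 3 * ∫ p, m 0 p * ∫ q, m 1 q * m 2 (p + (κ : ℤ) • q + w)) := by
        rw [Measure.volume_eq_prod] at hF_int ⊢
        rw [integral_prod _ hF_int]
        simp only [hF, integral_const_mul]
    _ ≤ _ := by
        gcongr
        exact integral_integral_dyadicMajorant_le hε (by linarith) hJ (fun i => (z i).re) κ w

theorem exists_dyadic_scale {ε : ℝ} (hε : 0 < ε) (hε₂ : ε ≤ 1 / 2) :
    ∃ J : ℕ, 1 ≤ J ∧ 8 < 2 ^ J * ε ∧ (J : ℝ) ≤ 8 * Real.log (1 / ε) := by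
  obtain ⟨n, hn_le, hn_lt⟩ := exists_nat_pow_near (x := 8 / ε)
    (by rw [one_le_div hε]; linarith) (one_lt_two (α := ℝ))
  refine ⟨n + 1, by lia, (div_lt_iff₀ hε).1 hn_lt, ?_⟩
  have hlog : Real.log 2 ≤ Real.log (1 / ε) :=
    Real.log_le_log two_pos ((le_div_iff₀ hε).2 (by linarith))
  have hn : n * Real.log 2 ≤ 3 * Real.log 2 + Real.log (1 / ε) :=
    calc n * Real.log 2 = Real.log (2 ^ n) := (Real.log_pow 2 n).symm
      _ ≤ Real.log (2 ^ 3 * (1 / ε)) :=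
        Real.log_le_log (by positivity) (hn_le.trans_eq (by ring))
      _ = 3 * Real.log 2 + Real.log (1 / ε) := by
        rw [Real.log_mul (by norm_num) (by positivity), Real.log_pow, Nat.cast_ofNat]
  push_cast
  nlinarith [Real.log_two_gt_d9]

end ResolventComparison

theorem rpow_mul_log_pow_three_lt {ε : ℝ} (hε : 0 < ε) (hε₁ : ε < 1) :
    ε ^ (-(3 / 4) : ℝ) * Real.log (1 / ε) ^ 3 <
      21 * ε ^ (-(4 / 5) : ℝ) * Real.log (1 / ε) ^ 2 := by
  have hlog_pos : 0 < Real.log (1 / ε) := Real.log_pos ((one_lt_div hε).2 hε₁)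
  have hlog_le : Real.log (1 / ε) ≤ 20 * ε ^ (-(1 / 20) : ℝ) := by
    have h := Real.log_le_rpow_div (x := 1 / ε) (ε := 1 / 20) (by positivity) (by norm_num)
    rw [one_div, Real.inv_rpow hε.le, ← Real.rpow_neg hε.le] at h
    rw [one_div]
    linarith
  calc ε ^ (-(3 / 4) : ℝ) * Real.log (1 / ε) ^ 3
      = ε ^ (-(3 / 4) : ℝ) * Real.log (1 / ε) ^ 2 * Real.log (1 / ε) := by ring
    _ ≤ ε ^ (-(3 / 4) : ℝ) * Real.log (1 / ε) ^ 2 * (20 * ε ^ (-(1 / 20) : ℝ)) := by gcongr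
    _ = 20 * (ε ^ (-(3 / 4) : ℝ) * ε ^ (-(1 / 20) : ℝ)) * Real.log (1 / ε) ^ 2 := by ring
    _ = 20 * ε ^ (-(4 / 5) : ℝ) * Real.log (1 / ε) ^ 2 := by
        rw [← Real.rpow_add hε]
        norm_num
    _ < 21 * ε ^ (-(4 / 5) : ℝ) * Real.log (1 / ε) ^ 2 := by
        gcongr
        norm_num

end LatticeCrossing

open LatticeCrossing MeasureTheory in
theorem lemma7p8_general :
    ∃ C : ℝ, 0 < C ∧ ∀ ε : ℝ, 0 < ε → ε ≤ 1 / 2 →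
      ∀ (s : Fin 3 → ℤˣ) (κ : ℤˣ) (z : Fin 3 → ℂ), (∀ i, z i ∈ contour ∪ conjContour) →
        ∀ w : Torus3,
          ∫⁻ x : Torus3 × Torus3,
              resolventModulus ε (s 0) (z 0) x.1 * resolventModulus ε (s 1) (z 1) x.2 *
                resolventModulus ε (s 2) (z 2) (x.1 + (κ : ℤ) • x.2 + w)
            ≤ ENNReal.ofReal (C * (ε ^ (-(3 / 4) : ℝ) * Real.log (1 / ε) ^ 3)) := by
  refine ⟨64 ^ 3 * (440 * (8 * 10 ^ 4) ^ 3), by norm_num, fun ε hε hε₂ s κ z hz w => ?_⟩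
  obtain ⟨J, hJ, hJε, hJ_le⟩ := exists_dyadic_scale hε hε₂
  refine (lintegral_resolventModulus_mul_le hε hε₂ hJ hJε s κ hz w).trans
    (ENNReal.ofReal_le_ofReal ?_)
  calc 64 ^ 3 * (440 * (J * 10 ^ 4) ^ 3 * ε ^ (-(3 / 4) : ℝ))
      ≤ 64 ^ 3 * (440 * (8 * Real.log (1 / ε) * 10 ^ 4) ^ 3 * ε ^ (-(3 / 4) : ℝ)) := by gcongr
    _ = _ := by ring

theorem lemma7p8 :
    ∃ C : ℝ, 0 < C ∧ ∀ ε : ℝ, 0 < ε → ε ≤ 1 / 2 →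
      ∀ (s : Fin 3 → ℤˣ) (κ : ℤˣ) (ν : Fin 3 → Fin 2),
        (⨆ w : LatticeCrossing.Torus3,
          ⨆ α ∈ LatticeCrossing.contour,
            ⨆ β ∈ LatticeCrossing.conjContour,
              LatticeCrossing.crossingIntegral s κ ν ε w α β)
          < ENNReal.ofReal (C * ε ^ (-(4 / 5) : ℝ) * (Real.log (1 / ε)) ^ 2) := by
  obtain ⟨C, hC, hbound⟩ := lemma7p8_general
  refine ⟨C * 21, by positivity, fun ε hε hε₂ s κ ν => ?_⟩
  have hlt : C * (ε ^ (-(3 / 4) : ℝ) * Real.log (1 / ε) ^ 3) <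
      C * 21 * ε ^ (-(4 / 5) : ℝ) * Real.log (1 / ε) ^ 2 := by
    have h := LatticeCrossing.rpow_mul_log_pow_three_lt hε (by linarith)
    simpa only [mul_assoc] using mul_lt_mul_of_pos_left h hC
  have hpos : 0 < Real.log (1 / ε) := Real.log_pos ((one_lt_div hε).2 (by linarith))
  refine lt_of_le_of_lt ?_ ((ENNReal.ofReal_lt_ofReal_iff (lt_trans (by positivity) hlt)).2 hlt)
  refine iSup_le fun w => iSup₂_le fun α hα => iSup₂_le fun β hβ =>
    hbound ε hε hε₂ s κ (fun i => ![α, β] (ν i)) (fun i => ?_) w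
  generalize ν i = j
  fin_cases j
  · exact .inl hα
  · exact .inr hβ
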